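/- Let $d\ge 0$ and let $u\in\mathscr S'(\mathbf R^d)$ belong to $\mathscr E'(\mathbf R^d)+\mathscr S(\mathbf R^d)$, i.e. $u$ is the sum of a compactly supported distribution and a Schwartz function. Then $$\mathrm{WF}_G(u)=\{0\}\times\pi_2\mathrm{WF}(u)=\{0\}\times\Sigma(u),$$ where $\pi_2(x,\xi)=\xi$ and the objects are defined as follows. Write $\langle z\rangle=(1+|z|^2)^{1/2}$, and let $$V_\varphi u(x,\xi)=(u,M_\xi T_x\varphi),\qquad M_\xi T_x\varphi(y)=e^{i\langle y,\xi\rangle}\varphi(y-x),\qquad x,\xi\in\mathbf R^d,\ \varphi\in\mathscr S(\mathbf R^d),$$ be the short-time Fourier transform, where $(\cdot,\cdot)$ is the action of $\mathscr S'$ on $\mathscr S$ that is conjugate linear in the second argument. "Conic" means invariant under multiplication by positive reals. - $\mathrm{WF}_G(u)\subseteq \mathbf R^{2d}\setminus 0$ is the Gabor wave front set: for a window $\varphi\in\mathscr S(\mathbf R^d)\setminus 0$, a point $z_0\in\mathbf R^{2d}\setminus 0$ is not in $\mathrm{WF}_G(u)$ if and only if there is an open conic set $\Gamma\subseteq\mathbf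 R^{2d}\setminus 0$ with $z_0\in\Gamma$ and $\sup_{z\in\Gamma}\langle z\rangle^N|V_\varphi u(z)|<\infty$ for all $N\ge 0$. The equalities hold for every choice of the window $\varphi\in\mathscr S(\mathbf R^d)\setminus 0$. - $\mathrm{WF}(u)\subseteq\mathbf R^d\times(\mathbf R^d\setminus 0)$ is the classical $C^\infty$ wave front set: $(x_0,\xi_0)$ with $\xi_0\ne 0$ is not in $\mathrm{WF}(u)$ if and only if there are $\varphi\in C_c^\infty(\mathbf R^d)$ with $\varphi(0)\neq 0$ and an open conic set $\Gamma_2\subseteq\mathbf R^d\setminus 0$ with $\xi_0\in\Gamma_2$ such that $\sup_{\xi\in\Gamma_2}\langle\xi\rangle^N|V_\varphi u(x_0,\xi)|<\infty$ for all $N\ge 0$. - $\Sigma(u)\subseteq\mathbf R^d\setminus 0$ is the cone of directions in which $\widehat u$ does not decay rapidly: $\eta\neq 0$ is not in $\Sigma(u)$ if and only if there is an open conic set $\Gamma_2\subseteq\mathbf R^d\setminus 0$ with $\eta\in\Gamma_2$ on which $\widehat u$ is a continuous function satisfying $\sup_{\xi\in\Gamma_2}\langle\xi\rangle^N|\widehat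 u(\xi)|<\infty$ for all $N\ge 0$. The Fourier transform extends $\widehat f(\xi)=\int_{\mathbf R^d}f(x)e^{-i\langle x,\xi\rangle}\,dx$, $f\in\mathscr S(\mathbf R^d)$, to $\mathscr S'(\mathbf R^d)$. -/

import Mathlib

open scoped SchwartzMap FourierTransform
open MeasureTheory

noncomputable section

namespace GaborWF

/-- The Euclidean space `ℝ^d`. -/
abbrev Rd (d : ℕ) := EuclideanSpace ℝ (Fin d)

/-! ### Time-frequency shifts and the short-time Fourier transform -/

/-- The function `y ↦ exp(i⟨y, ξ⟩)`. -/
def character {d : ℕ} (ξ y : Rd d) : ℂ := Complex.exp (Complex.I * ((inner ℝ y ξ : ℝ) : ℂ))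

theorem iteratedDeriv_exp_I (n : ℕ) :
    iteratedDeriv n (fun t : ℝ => Complex.exp (Complex.I * (t : ℂ))) =
      fun t : ℝ => Complex.I ^ n * Complex.exp (Complex.I * (t : ℂ)) := by
  induction n with
  | zero => simp
  | succ n ih =>
    rw [iteratedDeriv_succ, ih]
    funext t
    have h : HasDerivAt (fun t : ℝ => Complex.I * (t : ℂ)) (Complex.I * 1) t :=
      (Complex.ofRealCLM.hasDerivAt (x := t)).const_mul Complex.I
    rw [(h.cexp.const_mul (Complex.I ^ n)).deriv]
    ring

theorem hasTemperateGrowth_exp_I :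
    Function.HasTemperateGrowth (fun t : ℝ => Complex.exp (Complex.I * (t : ℂ))) := by
  refine ⟨?_, fun n => ⟨0, 1, fun t => ?_⟩⟩
  · exact (contDiff_const.mul Complex.ofRealCLM.contDiff).cexp
  · rw [norm_iteratedFDeriv_eq_norm_iteratedDeriv, iteratedDeriv_exp_I]
    simp [Complex.norm_exp]

theorem hasTemperateGrowth_character {d : ℕ} (ξ : Rd d) :
    Function.HasTemperateGrowth (character ξ) := by
  have h : Function.HasTemperateGrowth (fun y : Rd d => (inner ℝ y ξ : ℝ)) := by fun_prop
  exact hasTemperateGrowth_exp_I.comp h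

/-- The time-frequency shift `Π(x, ξ) = M_ξ T_x` on the Schwartz space. -/
def timeFreqShift {d : ℕ} (x ξ : Rd d) (ψ : 𝓢(Rd d, ℂ)) : 𝓢(Rd d, ℂ) :=
  SchwartzMap.smulLeftCLM ℂ (character ξ) (ψ.compSubConstCLM ℂ x)

theorem timeFreqShift_apply {d : ℕ} (x ξ : Rd d) (ψ : 𝓢(Rd d, ℂ)) (y : Rd d) :
    timeFreqShift x ξ ψ y =
      Complex.exp (Complex.I * ((inner ℝ y ξ : ℝ) : ℂ)) * ψ (y - x) := by
  simp [timeFreqShift, SchwartzMap.smulLeftCLM_apply_apply (hasTemperateGrowth_character ξ),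
    character]

/-- Complex conjugation on the Schwartz space. -/
def conjS {d : ℕ} (ψ : 𝓢(Rd d, ℂ)) : 𝓢(Rd d, ℂ) :=
  SchwartzMap.postcompCLM (𝕜 := ℝ) (Complex.conjCLE : ℂ →L[ℝ] ℂ) ψ

theorem conjS_apply {d : ℕ} (ψ : 𝓢(Rd d, ℂ)) (y : Rd d) :
    conjS ψ y = (starRingEnd ℂ) (ψ y) := rfl

/-- The action `(u, ψ)` of `u ∈ 𝓢'` on `ψ ∈ 𝓢`, conjugate linear in `ψ`; it extends the inner
product of `L²`, conjugate linear in the second argument. -/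
def sesq {d : ℕ} (u : 𝓢'(Rd d, ℂ)) (ψ : 𝓢(Rd d, ℂ)) : ℂ := u (conjS ψ)

/-- The short-time Fourier transform `V_ψ u (x, ξ) = (u, M_ξ T_x ψ)`. -/
def stft {d : ℕ} (ψ : 𝓢(Rd d, ℂ)) (u : 𝓢'(Rd d, ℂ)) (x ξ : Rd d) : ℂ :=
  sesq u (timeFreqShift x ξ ψ)

/-! ### Cones and brackets -/

/-- An open conic subset of `V ∖ 0`. -/
def IsOpenCone {V : Type*} [TopologicalSpace V] [AddCommGroup V] [Module ℝ V] (Γ : Set V) : Prop :=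
  IsOpen Γ ∧ (0 : V) ∉ Γ ∧ ∀ z ∈ Γ, ∀ t : ℝ, 0 < t → t • z ∈ Γ

/-- The bracket `⟨ξ⟩ = (1 + |ξ|²)^{1/2}` on `ℝ^d`. -/
def bracket {d : ℕ} (ξ : Rd d) : ℝ := Real.sqrt (1 + ‖ξ‖ ^ 2)

/-- The bracket `⟨(x, ξ)⟩ = (1 + |x|² + |ξ|²)^{1/2}` on phase space `ℝ^d × ℝ^d`
(where the norm is the Euclidean norm of `ℝ^{2d}`, not the maximum norm). -/
def phaseBracket {d : ℕ} (z : Rd d × Rd d) : ℝ := Real.sqrt (1 + (‖z.1‖ ^ 2 + ‖z.2‖ ^ 2))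

/-! ### The wave front sets -/

/-- The Gabor wave front set, defined with the window `φ`. -/
def gaborWF {d : ℕ} (φ : 𝓢(Rd d, ℂ)) (u : 𝓢'(Rd d, ℂ)) : Set (Rd d × Rd d) :=
  {z₀ | z₀ ≠ 0 ∧ ¬ ∃ Γ : Set (Rd d × Rd d), IsOpenCone Γ ∧ z₀ ∈ Γ ∧
    ∀ N : ℕ, ∃ C : ℝ, ∀ z ∈ Γ, phaseBracket z ^ N * ‖stft φ u z.1 z.2‖ ≤ C}

/-- The classical `C^∞` wave front set. The functions `φ` below are exactly those in
`C_c^∞(ℝ^d)` with `φ 0 ≠ 0`. -/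
def classicalWF {d : ℕ} (u : 𝓢'(Rd d, ℂ)) : Set (Rd d × Rd d) :=
  {p | p.2 ≠ 0 ∧ ¬ ∃ (φ : 𝓢(Rd d, ℂ)) (Γ : Set (Rd d)),
    HasCompactSupport φ ∧ φ 0 ≠ 0 ∧ IsOpenCone Γ ∧ p.2 ∈ Γ ∧
    ∀ N : ℕ, ∃ C : ℝ, ∀ ξ ∈ Γ, bracket ξ ^ N * ‖stft φ u p.1 ξ‖ ≤ C}

/-! ### The Fourier transform and the cone `Σ(u)` -/

/-- The dilation `ξ ↦ ξ / (2π)`. -/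
def scaling (d : ℕ) : Rd d ≃L[ℝ] Rd d :=
  ContinuousLinearEquiv.smulLeft (Units.mk0 (2 * Real.pi)⁻¹ (by positivity))

/-- The Fourier transform on `𝓢(ℝ^d)`, normalized as `∫ f(x) exp(-i⟨x, ξ⟩) dx`. -/
def fourierS (d : ℕ) : 𝓢(Rd d, ℂ) →L[ℂ] 𝓢(Rd d, ℂ) :=
  (SchwartzMap.compCLMOfContinuousLinearEquiv ℂ (scaling d)).comp
    (FourierTransform.fourierCLM ℂ 𝓢(Rd d, ℂ))

theorem fourierS_apply {d : ℕ} (f : 𝓢(Rd d, ℂ)) (ξ : Rd d) :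
    fourierS d f ξ = ∫ x : Rd d, f x * Complex.exp (-Complex.I * ((inner ℝ x ξ : ℝ) : ℂ)) := by
  have h : fourierS d f ξ = (𝓕 (f : Rd d → ℂ)) ((2 * Real.pi)⁻¹ • ξ) := by
    rw [← SchwartzMap.fourier_coe]; rfl
  rw [h, Real.fourier_eq']
  congr 1
  funext x
  have hp : (Real.pi : ℂ) ≠ 0 := by exact_mod_cast Real.pi_ne_zero
  rw [smul_eq_mul, mul_comm, inner_smul_right]
  congr 2
  push_cast
  field_simp

/-- The Fourier transform on `𝓢'(ℝ^d)`, by duality: `⟨û, ψ⟩ = ⟨u, ψ̂⟩`. -/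
def fourierT {d : ℕ} (u : 𝓢'(Rd d, ℂ)) : 𝓢'(Rd d, ℂ) :=
  PointwiseConvergenceCLM.precomp ℂ (fourierS d) u

theorem fourierT_apply {d : ℕ} (u : 𝓢'(Rd d, ℂ)) (ψ : 𝓢(Rd d, ℂ)) :
    fourierT u ψ = u (fourierS d ψ) := rfl

/-- The distribution `v` coincides on the open set `Γ` with the continuous function `g`. -/
def EqOnOpen {d : ℕ} (v : 𝓢'(Rd d, ℂ)) (g : Rd d → ℂ) (Γ : Set (Rd d)) : Prop :=
  ContinuousOn g Γ ∧ ∀ ψ : 𝓢(Rd d, ℂ), HasCompactSupport ψ → tsupport ψ ⊆ Γ →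
    v ψ = ∫ ξ : Rd d, g ξ * ψ ξ

/-- The cone `Σ(u)`: a direction `η ≠ 0` lies outside it if on some open cone around `η` the
Fourier transform of `u` is a (continuous, hence unique) function that decays rapidly. -/
def sigmaCone {d : ℕ} (u : 𝓢'(Rd d, ℂ)) : Set (Rd d) :=
  {η | η ≠ 0 ∧ ¬ ∃ (Γ : Set (Rd d)) (g : Rd d → ℂ), IsOpenCone Γ ∧ η ∈ Γ ∧
    EqOnOpen (fourierT u) g Γ ∧
    ∀ N : ℕ, ∃ C : ℝ, ∀ ξ ∈ Γ, bracket ξ ^ N * ‖g ξ‖ ≤ C}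

/-! ### The space `𝓔' + 𝓢` -/

/-- Membership in `𝓔'(ℝ^d)`: the (automatically tempered) distributions of compact support,
that is, those that vanish outside some compact set. -/
def IsCompactlySupported {d : ℕ} (v : 𝓢'(Rd d, ℂ)) : Prop :=
  ∃ K : Set (Rd d), IsCompact K ∧ Distribution.IsVanishingOn v Kᶜ

/-- Membership in `𝓔'(ℝ^d) + 𝓢(ℝ^d)`, a Schwartz function `f` being identified with the
distribution `ψ ↦ ∫ f ψ`. -/
def MemEPrimeAddSchwartz {d : ℕ} (u : 𝓢'(Rd d, ℂ)) : Prop :=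
  ∃ (v : 𝓢'(Rd d, ℂ)) (f : 𝓢(Rd d, ℂ)), IsCompactlySupported v ∧
    u = v + SchwartzMap.toTemperedDistributionCLM (Rd d) ℂ volume f

end GaborWF

end

/-! Everything is read off from one function. With a cutoff `χ` equal to 1 near the support of the
compactly supported part, `u = χu + f` with `f` Schwartz (`exists_localization`), so the Fourier
transform of `u` is a continuous function `G` of polynomial growth, the sum of `u (modS ξ χ)` and
the transform of `f` (`localized_fourier`, `hasFourierDensity_of_localization`). By uniqueness of
continuous densities, the cone `Σ(u)` consists of the nonzero directions without a conic
neighbourhood on which `G` decays rapidly. With `θ` the inverse transform of the conjugate window,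
`V_φ u(x, ξ) = ∫ G(ζ + ξ) exp(i⟨x, ζ⟩) θ(ζ) dζ`.

Decay of `G` gives regularity: averaging translates of `G` against a Schwartz function preserves
rapid decay, on a smaller cone (`exists_cone_integral_shift`). The exponential has modulus 1, so the
bound is uniform in `x` and serves both wave front sets.

Conversely, `V_φ u` decays to every order in `x` with a fixed polynomial loss in `ξ`
(`exists_stft_decay`). Hence no point with `x ≠ 0` lies in the Gabor wave front set, and Gabor
regularity at `(0, η)` controls `V_φ u(x, ξ)` for all `x` once `ξ` is in a cone around `η`. Fourier
inversion in `x` then recovers the decay of `G` (`HasFourierDensity.norm_mul_le_of_stft_le`).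

If no `(x, η)` is in the classical wave front set, compactness of the support of `χ` leaves finitely
many windows. A partition built from them (`exists_partition`) writes the transform of `χu` as a
finite sum of averages of functions decaying near `η`. -/

noncomputable section

namespace GaborWF

variable {d : ℕ}

/-! ### Multiplication, modulation and translation on the Schwartz space -/

/-- Multiplication by a Schwartz function. -/
def mulS (χ : 𝓢(Rd d, ℂ)) : 𝓢(Rd d, ℂ) →L[ℂ] 𝓢(Rd d, ℂ) := SchwartzMap.smulLeftCLM ℂ χ

@[simp]
theorem mulS_apply (χ g : 𝓢(Rd d, ℂ)) (y : Rd d) : mulS χ g y = χ y * g y := by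
  simp [mulS, SchwartzMap.smulLeftCLM_apply_apply χ.hasTemperateGrowth]

/-- Multiplication by `y ↦ exp(-i⟨y, ξ⟩)`. -/
def modS (ξ : Rd d) : 𝓢(Rd d, ℂ) →L[ℂ] 𝓢(Rd d, ℂ) := SchwartzMap.smulLeftCLM ℂ (character (-ξ))

@[simp]
theorem modS_apply (ξ : Rd d) (g : 𝓢(Rd d, ℂ)) (y : Rd d) :
    modS ξ g y = character (-ξ) y * g y := by
  simp [modS, SchwartzMap.smulLeftCLM_apply_apply (hasTemperateGrowth_character _)]

/-- Translation of Schwartz functions. -/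
def transS (x : Rd d) : 𝓢(Rd d, ℂ) →L[ℂ] 𝓢(Rd d, ℂ) := SchwartzMap.compSubConstCLM ℂ x

@[simp]
theorem transS_apply (x : Rd d) (g : 𝓢(Rd d, ℂ)) (y : Rd d) : transS x g y = g (y - x) := rfl

theorem norm_character (ξ y : Rd d) : ‖character ξ y‖ = 1 := by
  rw [character, mul_comm, Complex.norm_exp_ofReal_mul_I]

theorem character_add_right (ξ x y : Rd d) :
    character ξ (x + y) = character ξ x * character ξ y := by
  simp [character, ← Complex.exp_add, inner_add_left, mul_add]

theorem modS_mulS (ξ : Rd d) (χ g : 𝓢(Rd d, ℂ)) : modS ξ (mulS χ g) = mulS χ (modS ξ g) := by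
  ext y; simp [mul_left_comm]

theorem stft_eq (ψ : 𝓢(Rd d, ℂ)) (u : 𝓢'(Rd d, ℂ)) (x ξ : Rd d) :
    stft ψ u x ξ = u (modS ξ (transS x (conjS ψ))) := by
  unfold stft sesq
  congr 1
  ext y
  simp [conjS_apply, timeFreqShift_apply, character, ← Complex.exp_conj]

/-! ### The Fourier transform on the Schwartz space -/

theorem fourierS_apply' (f : 𝓢(Rd d, ℂ)) (ξ : Rd d) :
    fourierS d f ξ = ∫ x : Rd d, f x * character (-ξ) x := by
  rw [fourierS_apply]
  simp [character]

/-- The inverse of `fourierS`. -/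
def fourierInvS (d : ℕ) : 𝓢(Rd d, ℂ) →L[ℂ] 𝓢(Rd d, ℂ) :=
  (FourierTransform.fourierInvCLM ℂ 𝓢(Rd d, ℂ)).comp
    (SchwartzMap.compCLMOfContinuousLinearEquiv ℂ (scaling d).symm)

theorem fourierS_eq (f : 𝓢(Rd d, ℂ)) (ξ : Rd d) : fourierS d f ξ = 𝓕 f (scaling d ξ) := rfl

@[simp]
theorem fourierS_fourierInvS (f : 𝓢(Rd d, ℂ)) : fourierS d (fourierInvS d f) = f := by
  ext ξ
  simp [fourierS, fourierInvS]

@[simp]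
theorem fourierInvS_fourierS (f : 𝓢(Rd d, ℂ)) : fourierInvS d (fourierS d f) = f := by
  have h : SchwartzMap.compCLMOfContinuousLinearEquiv ℂ (scaling d).symm (fourierS d f) = 𝓕 f := by
    ext ξ
    simp [fourierS]
  simp [fourierInvS, h]

theorem fourierS_injective : Function.Injective (fourierS d) :=
  Function.LeftInverse.injective fourierInvS_fourierS

theorem fourierS_transS (ξ : Rd d) (k : 𝓢(Rd d, ℂ)) :
    fourierS d (transS ξ k) = modS ξ (fourierS d k) := by
  ext y
  rw [fourierS_apply', modS_apply, fourierS_apply', ← integral_const_mul,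
    ← integral_add_right_eq_self _ ξ]
  congr 1
  ext x
  simp only [transS_apply, add_sub_cancel_right, character_add_right]
  have : character (-y) ξ = character (-ξ) y := by simp [character, real_inner_comm]
  rw [this]; ring

theorem fourierS_modS (x : Rd d) (k : 𝓢(Rd d, ℂ)) :
    fourierS d (modS (-x) k) = transS x (fourierS d k) := by
  ext y
  rw [fourierS_apply', transS_apply, fourierS_apply']
  congr 1
  ext z
  have h : character (-(y - x)) z = character (-(-x)) z * character (-y) z := by
    simp only [character, ← Complex.exp_add, ← mul_add, ← Complex.ofReal_add, ← inner_add_right]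
    congr 4
    abel
  rw [modS_apply, h]
  ring

theorem fourierInvS_modS (ξ : Rd d) (g : 𝓢(Rd d, ℂ)) :
    fourierInvS d (modS ξ g) = transS ξ (fourierInvS d g) :=
  fourierS_injective (by simp [fourierS_transS])

theorem fourierInvS_transS (x : Rd d) (g : 𝓢(Rd d, ℂ)) :
    fourierInvS d (transS x g) = modS (-x) (fourierInvS d g) :=
  fourierS_injective (by simp [fourierS_modS])

theorem integral_mul_fourierS (f h : 𝓢(Rd d, ℂ)) :
    ∫ x, f x * fourierS d h x = ∫ x, fourierS d f x * h x := by
  simp_rw [fourierS_apply', ← integral_const_mul, ← integral_mul_const]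
  rw [integral_integral_swap]
  · refine integral_congr_ae (.of_forall fun y => integral_congr_ae (.of_forall fun x => ?_))
    have : character (-x) y = character (-y) x := by simp [character, real_inner_comm]
    simp only [this]
    ring
  · refine (f.integrable.mul_prod h.integrable).mono ?_ (.of_forall fun p => ?_)
    · have : Continuous fun p : Rd d × Rd d => f p.1 * (h p.2 * character (-p.1) p.2) := by
        unfold character
        fun_prop
      exact this.aestronglyMeasurable
    · simp [Function.uncurry, norm_character]

/-- Convolution of Schwartz functions. -/
def convS (k h : 𝓢(Rd d, ℂ)) : 𝓢(Rd d, ℂ) :=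
  SchwartzMap.convolution (ContinuousLinearMap.mul ℂ ℂ) k h

theorem fourierS_convS (k h : 𝓢(Rd d, ℂ)) :
    fourierS d (convS k h) = mulS (fourierS d k) (fourierS d h) := by
  ext ξ
  simp [fourierS_eq, convS, SchwartzMap.fourier_convolution]

theorem convS_apply (k h : 𝓢(Rd d, ℂ)) (ζ : Rd d) :
    convS k h ζ = ∫ a, k (ζ - a) * h a := by
  rw [convS, ← SchwartzMap.convolution_flip, SchwartzMap.convolution_apply]
  simp [convolution_def, mul_comm]

/-! ### Weights and Schwartz seminorms -/

theorem one_add_norm_add_le (x y : Rd d) : 1 + ‖x + y‖ ≤ (1 + ‖x‖) * (1 + ‖y‖) := by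
  nlinarith [norm_add_le x y, norm_nonneg x, norm_nonneg y,
    mul_nonneg (norm_nonneg x) (norm_nonneg y)]

theorem one_add_norm_pow_le (x y : Rd d) (N : ℕ) :
    (1 + ‖x‖) ^ N ≤ (1 + ‖x - y‖) ^ N * (1 + ‖y‖) ^ N := by
  rw [← mul_pow]
  gcongr
  simpa using one_add_norm_add_le (x - y) y

theorem exists_decay_iteratedFDeriv (k : 𝓢(Rd d, ℂ)) (N n : ℕ) :
    ∃ C, 0 ≤ C ∧ ∀ ζ, (1 + ‖ζ‖) ^ N * ‖iteratedFDeriv ℝ n k ζ‖ ≤ C :=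
  ⟨_, by positivity, fun ζ =>
    SchwartzMap.one_add_le_sup_seminorm_apply (𝕜 := ℂ) (m := (N, n)) le_rfl le_rfl k ζ⟩

theorem exists_decay (k : 𝓢(Rd d, ℂ)) (N : ℕ) :
    ∃ C, 0 ≤ C ∧ ∀ ζ, (1 + ‖ζ‖) ^ N * ‖k ζ‖ ≤ C := by
  simpa using exists_decay_iteratedFDeriv k N 0

theorem integrable_one_add_norm_pow_mul (k : 𝓢(Rd d, ℂ)) (N : ℕ) :
    Integrable fun ζ => (1 + ‖ζ‖) ^ N * ‖k ζ‖ := by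
  have h : ∀ ζ : Rd d, (1 + ‖ζ‖) ^ N * ‖k ζ‖ =
      ∑ m ∈ Finset.range (N + 1), (N.choose m : ℝ) * (‖ζ‖ ^ (N - m) * ‖k ζ‖) := fun ζ => by
    rw [add_pow, Finset.sum_mul]
    refine Finset.sum_congr rfl fun m _ => ?_
    simp; ring
  simp_rw [h]
  exact integrable_finsetSum _ fun m _ => (k.integrable_pow_mul volume _).const_mul _

/-- Leibniz rule: `k + N` powers of decay of the derivatives of `χ` pay for the weight of the
seminorm and for the growth allowed to `g`. The constant is independent of `g`. -/
theorem exists_seminorm_mulS_le (χ : 𝓢(Rd d, ℂ)) (k n N : ℕ) :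
    ∃ C, 0 ≤ C ∧ ∀ (g : 𝓢(Rd d, ℂ)) (A : ℝ), 0 ≤ A →
      (∀ j ≤ n, ∀ y, ‖iteratedFDeriv ℝ j g y‖ ≤ A * (1 + ‖y‖) ^ N) →
      SchwartzMap.seminorm ℂ k n (mulS χ g) ≤ C * A := by
  choose C hC0 hC using fun i => exists_decay_iteratedFDeriv χ (k + N) i
  refine ⟨∑ i ∈ Finset.range (n + 1), (n.choose i : ℝ) * C i,
    Finset.sum_nonneg fun i _ => mul_nonneg (by positivity) (hC0 i), fun g A hA hg => ?_⟩
  refine SchwartzMap.seminorm_le_bound ℂ k n _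
    (mul_nonneg (Finset.sum_nonneg fun i _ => mul_nonneg (by positivity) (hC0 i)) hA) fun y => ?_
  have he : (mulS χ g : Rd d → ℂ) = fun y => χ y * g y := by ext y; simp
  rw [he]
  have hl := norm_iteratedFDeriv_mul_le (N := (n : ℕ∞)) (χ.smooth n) (g.smooth n) y
    (n := n) le_rfl
  calc ‖y‖ ^ k * ‖iteratedFDeriv ℝ n (fun y => χ y * g y) y‖
      ≤ (1 + ‖y‖) ^ k * ∑ i ∈ Finset.range (n + 1), (n.choose i : ℝ) *
          ‖iteratedFDeriv ℝ i χ y‖ * ‖iteratedFDeriv ℝ (n - i) g y‖ := by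
        gcongr
        linarith
    _ ≤ (1 + ‖y‖) ^ k * ∑ i ∈ Finset.range (n + 1), (n.choose i : ℝ) *
          ‖iteratedFDeriv ℝ i χ y‖ * (A * (1 + ‖y‖) ^ N) := by
        gcongr with i _
        exact hg _ (Nat.sub_le _ _) y
    _ = ∑ i ∈ Finset.range (n + 1), (n.choose i : ℝ) *
          ((1 + ‖y‖) ^ (k + N) * ‖iteratedFDeriv ℝ i χ y‖) * A := by
        rw [Finset.mul_sum]
        refine Finset.sum_congr rfl fun i _ => ?_
        ring
    _ ≤ ∑ i ∈ Finset.range (n + 1), (n.choose i : ℝ) * C i * A := by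
        gcongr with i _
        exact hC i y
    _ = _ := by rw [Finset.sum_mul]

/-- A continuous seminorm of `χ g`, with `χ` a Schwartz function, is controlled by
finitely many derivatives of `g`, measured with any polynomial weight. -/
theorem exists_continuousSeminorm_mulS_le (χ : 𝓢(Rd d, ℂ)) (q : Seminorm ℂ 𝓢(Rd d, ℂ))
    (hq : Continuous q) (N : ℕ) :
    ∃ (n : ℕ) (C : ℝ), 0 ≤ C ∧ ∀ (g : 𝓢(Rd d, ℂ)) (A : ℝ), 0 ≤ A →
      (∀ j ≤ n, ∀ y, ‖iteratedFDeriv ℝ j g y‖ ≤ A * (1 + ‖y‖) ^ N) →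
      q (mulS χ g) ≤ C * A := by
  obtain ⟨s, C, -, hs⟩ := Seminorm.bound_of_continuous (schwartz_withSeminorms ℂ (Rd d) ℂ) q hq
  choose D hD0 hD using fun m : ℕ × ℕ => exists_seminorm_mulS_le χ m.1 m.2 N
  refine ⟨s.sup Prod.snd, C * ∑ m ∈ s, D m,
    mul_nonneg C.2 (Finset.sum_nonneg fun m _ => hD0 m), fun g A hA hg => ?_⟩
  have h1 : q (mulS χ g) ≤ C * (s.sup (schwartzSeminormFamily ℂ (Rd d) ℂ)) (mulS χ g) := hs _
  refine h1.trans ?_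
  rw [mul_assoc]
  refine mul_le_mul_of_nonneg_left ?_ C.2
  refine Seminorm.finset_sup_apply_le
    (mul_nonneg (Finset.sum_nonneg fun m _ => hD0 m) hA) fun m hm => ?_
  refine (hD m g A hA fun j hj => hg j (hj.trans (Finset.le_sup (f := Prod.snd) hm))).trans ?_
  exact mul_le_mul_of_nonneg_right (Finset.single_le_sum (fun m _ => hD0 m) hm) hA

/-- The seminorm `|u(·)|`. -/
def absSeminorm (u : 𝓢'(Rd d, ℂ)) : Seminorm ℂ 𝓢(Rd d, ℂ) :=
  (normSeminorm ℂ ℂ).comp (u : 𝓢(Rd d, ℂ) →ₗ[ℂ] ℂ)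

theorem continuous_absSeminorm (u : 𝓢'(Rd d, ℂ)) : Continuous (absSeminorm u) :=
  (map_continuous u).norm

/-- Derivatives of a Fourier transform are bounded by moments of the function. The single weight of
order `n` serves all `j ≤ n`. -/
theorem norm_iteratedFDeriv_fourierS_le (h : 𝓢(Rd d, ℂ)) {j n : ℕ} (hj : j ≤ n) (y : Rd d) :
    ‖iteratedFDeriv ℝ j (fourierS d h) y‖ ≤
      (‖(scaling d : Rd d →L[ℝ] Rd d)‖ ^ j * (2 * Real.pi) ^ j * (j + 1)) *
        ∫ v, (1 + ‖v‖) ^ n * ‖h v‖ := by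
  have he : (fourierS d h : Rd d → ℂ) = 𝓕 (h : Rd d → ℂ) ∘ (scaling d : Rd d →L[ℝ] Rd d) := by
    ext y; rw [fourierS_eq]; rfl
  have hsm : ContDiff ℝ j (𝓕 (h : Rd d → ℂ)) := (𝓕 h).smooth j
  have h1 : ‖iteratedFDeriv ℝ j (𝓕 (h : Rd d → ℂ) ∘ (scaling d : Rd d →L[ℝ] Rd d)) y‖ ≤
      ‖iteratedFDeriv ℝ j (𝓕 (h : Rd d → ℂ)) ((scaling d : Rd d →L[ℝ] Rd d) y)‖ *
        ‖(scaling d : Rd d →L[ℝ] Rd d)‖ ^ j := by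
    rw [(scaling d : Rd d →L[ℝ] Rd d).iteratedFDeriv_comp_right hsm y le_rfl]
    refine (ContinuousMultilinearMap.norm_compContinuousLinearMap_le _ _).trans (by simp)
  have h2 := Real.pow_mul_norm_iteratedFDeriv_fourier_le (f := h) (K := ⊤) (N := ⊤)
    (h.smooth ⊤) (fun k n _ _ => h.integrable_pow_mul_iteratedFDeriv volume k n)
    (k := j) (n := 0) le_top le_top ((scaling d : Rd d →L[ℝ] Rd d) y)
  simp only [pow_zero, one_mul, mul_one, zero_add, Finset.range_one, Finset.sum_product,
    Finset.sum_singleton, norm_iteratedFDeriv_zero] at h2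
  have h3 : ∑ x ∈ Finset.range (j + 1), ∫ v, ‖v‖ ^ x * ‖h v‖ ≤
      (j + 1) * ∫ v, (1 + ‖v‖) ^ n * ‖h v‖ := by
    have := Finset.sum_le_card_nsmul (Finset.range (j + 1)) (fun x => ∫ v, ‖v‖ ^ x * ‖h v‖)
      (∫ v, (1 + ‖v‖) ^ n * ‖h v‖) fun x hx => ?_
    · simpa using this
    · refine integral_mono (h.integrable_pow_mul volume x) (integrable_one_add_norm_pow_mul h n)
        fun v => ?_
      have hx' : x ≤ n := by have := Finset.mem_range.1 hx; omega
      have : ‖v‖ ^ x ≤ (1 + ‖v‖) ^ n :=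
        (pow_le_pow_left₀ (norm_nonneg v) (by linarith) x).trans
          (pow_le_pow_right₀ (by linarith [norm_nonneg v]) hx')
      exact mul_le_mul_of_nonneg_right this (norm_nonneg _)
  rw [he]
  refine h1.trans ?_
  calc _ ≤ ((2 * Real.pi) ^ j * ((j + 1) * ∫ v, (1 + ‖v‖) ^ n * ‖h v‖)) *
        ‖(scaling d : Rd d →L[ℝ] Rd d)‖ ^ j := by
        gcongr
        exact h2.trans (by gcongr)
    _ = _ := by ring

theorem exists_norm_mulS_fourierS_le (u : 𝓢'(Rd d, ℂ)) (χ : 𝓢(Rd d, ℂ)) :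
    ∃ (n : ℕ) (C : ℝ), 0 ≤ C ∧ ∀ h : 𝓢(Rd d, ℂ),
      ‖u (mulS χ (fourierS d h))‖ ≤ C * ∫ v, (1 + ‖v‖) ^ n * ‖h v‖ := by
  obtain ⟨n, C, hC0, hC⟩ :=
    exists_continuousSeminorm_mulS_le χ (absSeminorm u) (continuous_absSeminorm u) 0
  set c : ℕ → ℝ := fun j => ‖(scaling d : Rd d →L[ℝ] Rd d)‖ ^ j * (2 * Real.pi) ^ j * (j + 1)
  have hc : ∀ j, 0 ≤ c j := fun j => by positivity
  refine ⟨n, C * ∑ j ∈ Finset.range (n + 1), c j,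
    mul_nonneg hC0 (Finset.sum_nonneg fun j _ => hc j), fun h => ?_⟩
  have hI : 0 ≤ ∫ v, (1 + ‖v‖) ^ n * ‖h v‖ := integral_nonneg fun v => by positivity
  rw [mul_assoc]
  refine hC _ _ (mul_nonneg (Finset.sum_nonneg fun j _ => hc j) hI) fun j hj y => ?_
  rw [pow_zero, mul_one]
  refine (norm_iteratedFDeriv_fourierS_le h hj y).trans ?_
  exact mul_le_mul_of_nonneg_right
    (Finset.single_le_sum (fun j _ => hc j) (Finset.mem_range.2 (by omega))) hI

/-! ### Functions of polynomial growth as densities of tempered distributions -/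

/-- Measurable functions that are integrable against some negative power of `1 + |ζ|`. -/
def TemperedDensity (F : Rd d → ℂ) : Prop :=
  ∃ N : ℕ, Integrable fun ζ => ((1 + ‖ζ‖) ^ N)⁻¹ • F ζ

/-- Continuous functions of polynomial growth. -/
def PolyGrowth (F : Rd d → ℂ) : Prop :=
  Continuous F ∧ ∃ (N : ℕ) (C : ℝ), 0 ≤ C ∧ ∀ ζ, ‖F ζ‖ ≤ C * (1 + ‖ζ‖) ^ N

theorem integrable_inv_one_add_norm_pow :
    Integrable fun ζ : Rd d => ((1 + ‖ζ‖) ^ (d + 1))⁻¹ := by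
  have h := integrable_one_add_norm (E := Rd d) (μ := volume) (r := d + 1) (by simp)
  refine h.congr (.of_forall fun ζ => ?_)
  have : (0 : ℝ) ≤ 1 + ‖ζ‖ := by positivity
  simp only
  rw [Real.rpow_neg this]
  norm_cast

theorem continuous_inv_one_add_norm_pow (N : ℕ) :
    Continuous fun ζ : Rd d => ((1 + ‖ζ‖) ^ N)⁻¹ :=
  Continuous.inv₀ (by fun_prop) fun ζ => by positivity

theorem TemperedDensity.aestronglyMeasurable {F : Rd d → ℂ} (hF : TemperedDensity F) :
    AEStronglyMeasurable F := by
  obtain ⟨N, hN⟩ := hF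
  have h : AEStronglyMeasurable fun ζ : Rd d => (1 + ‖ζ‖) ^ N • (((1 + ‖ζ‖) ^ N)⁻¹ • F ζ) :=
    AEStronglyMeasurable.smul (f := fun ζ : Rd d => (1 + ‖ζ‖) ^ N) (by fun_prop)
      hN.aestronglyMeasurable
  refine h.congr (.of_forall fun ζ => ?_)
  have : (1 + ‖ζ‖) ^ N ≠ 0 := by positivity
  simp only [smul_smul, mul_inv_cancel₀ this, one_smul]

theorem PolyGrowth.temperedDensity {F : Rd d → ℂ} (hF : PolyGrowth F) : TemperedDensity F := by
  obtain ⟨hc, N, C, -, hC⟩ := hF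
  refine ⟨N + (d + 1), (integrable_inv_one_add_norm_pow.const_mul C).mono'
    (((continuous_inv_one_add_norm_pow _).smul hc).aestronglyMeasurable) (.of_forall fun ζ => ?_)⟩
  have h1 : 0 < (1 + ‖ζ‖) ^ N := by positivity
  have h2 : 0 < (1 + ‖ζ‖) ^ (d + 1) := by positivity
  rw [norm_smul, Real.norm_of_nonneg (by positivity), pow_add, mul_inv]
  calc _ ≤ ((1 + ‖ζ‖) ^ N)⁻¹ * ((1 + ‖ζ‖) ^ (d + 1))⁻¹ * (C * (1 + ‖ζ‖) ^ N) := by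
        gcongr
        exact hC ζ
    _ = _ := by field_simp

theorem PolyGrowth.add {F G : Rd d → ℂ} (hF : PolyGrowth F) (hG : PolyGrowth G) :
    PolyGrowth fun ζ => F ζ + G ζ := by
  obtain ⟨hc, N, C, h0, hC⟩ := hF
  obtain ⟨hc', N', C', h0', hC'⟩ := hG
  refine ⟨hc.add hc', max N N', C + C', add_nonneg h0 h0', fun ζ => ?_⟩
  have h1 : 1 ≤ 1 + ‖ζ‖ := by linarith [norm_nonneg ζ]
  calc ‖F ζ + G ζ‖ ≤ C * (1 + ‖ζ‖) ^ N + C' * (1 + ‖ζ‖) ^ N' :=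
        (norm_add_le _ _).trans (add_le_add (hC ζ) (hC' ζ))
    _ ≤ C * (1 + ‖ζ‖) ^ max N N' + C' * (1 + ‖ζ‖) ^ max N N' := by
        gcongr <;> first | exact h1 | exact le_max_left _ _ | exact le_max_right _ _
    _ = _ := by ring

theorem polyGrowth_schwartz (k : 𝓢(Rd d, ℂ)) : PolyGrowth k := by
  obtain ⟨C, h0, hC⟩ := exists_decay k 0
  exact ⟨k.continuous, 0, C, h0, fun ζ => by simpa using hC ζ⟩

/-- Peetre's inequality turns decay of `k` in `ζ - a` into decay in `ζ`, at a polynomial price in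
`a`. -/
theorem exists_norm_mul_transS_le {F : Rd d → ℂ} {N : ℕ} (k : 𝓢(Rd d, ℂ)) :
    ∃ C, 0 ≤ C ∧ ∀ ζ a, ‖F ζ * k (ζ - a)‖ ≤
      C * (1 + ‖a‖) ^ N * ‖((1 + ‖ζ‖) ^ N)⁻¹ • F ζ‖ := by
  obtain ⟨C, h0, hC⟩ := exists_decay k N
  refine ⟨C, h0, fun ζ a => ?_⟩
  have hp := one_add_norm_pow_le ζ a N
  have hk := hC (ζ - a)
  have h1 : 0 < (1 + ‖ζ‖) ^ N := by positivity
  rw [norm_mul, norm_smul, Real.norm_of_nonneg (by positivity)]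
  rw [show C * (1 + ‖a‖) ^ N * (((1 + ‖ζ‖) ^ N)⁻¹ * ‖F ζ‖) =
    ‖F ζ‖ * (C * (1 + ‖a‖) ^ N / (1 + ‖ζ‖) ^ N) by ring]
  refine mul_le_mul_of_nonneg_left ?_ (norm_nonneg _)
  rw [le_div_iff₀ h1]
  calc ‖k (ζ - a)‖ * (1 + ‖ζ‖) ^ N ≤ ‖k (ζ - a)‖ * ((1 + ‖ζ - a‖) ^ N * (1 + ‖a‖) ^ N) := by gcongr
    _ = ((1 + ‖ζ - a‖) ^ N * ‖k (ζ - a)‖) * (1 + ‖a‖) ^ N := by ring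
    _ ≤ _ := by gcongr

theorem TemperedDensity.integrable_mul_transS {F : Rd d → ℂ} (hF : TemperedDensity F)
    (k : 𝓢(Rd d, ℂ)) (a : Rd d) : Integrable fun ζ => F ζ * k (ζ - a) := by
  have hm := hF.aestronglyMeasurable
  obtain ⟨N, hN⟩ := hF
  obtain ⟨C, -, hC⟩ := exists_norm_mul_transS_le (F := F) (N := N) k
  exact (hN.norm.const_mul (C * (1 + ‖a‖) ^ N)).mono'
    (hm.mul (by fun_prop)) (.of_forall fun ζ => hC ζ a)

theorem TemperedDensity.integrable_mul {F : Rd d → ℂ} (hF : TemperedDensity F)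
    (k : 𝓢(Rd d, ℂ)) : Integrable fun ζ => F ζ * k ζ := by
  simpa using hF.integrable_mul_transS k 0

theorem TemperedDensity.polyGrowth_conv {F : Rd d → ℂ} (hF : TemperedDensity F)
    (k : 𝓢(Rd d, ℂ)) : PolyGrowth fun a => ∫ ζ, F ζ * k (ζ - a) := by
  have hi := hF.integrable_mul_transS k
  obtain ⟨N, hN⟩ := hF
  obtain ⟨C, h0, hC⟩ := exists_norm_mul_transS_le (F := F) (N := N) k
  refine ⟨continuous_iff_continuousAt.2 fun a => ?_, N, C * ∫ ζ, ‖((1 + ‖ζ‖) ^ N)⁻¹ • F ζ‖,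
    mul_nonneg h0 (integral_nonneg fun _ => norm_nonneg _), fun a => ?_⟩
  · refine continuousAt_of_dominated (bound := fun ζ =>
      C * (1 + (‖a‖ + 1)) ^ N * ‖((1 + ‖ζ‖) ^ N)⁻¹ • F ζ‖)
      (.of_forall fun b => (hi b).aestronglyMeasurable) ?_ (hN.norm.const_mul _) ?_
    · filter_upwards [Metric.ball_mem_nhds a one_pos] with b hb
      refine .of_forall fun ζ => (hC ζ b).trans ?_
      have : ‖b‖ ≤ ‖a‖ + 1 := by
        have := norm_sub_norm_le b a
        rw [mem_ball_iff_norm] at hb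
        linarith
      gcongr
    · exact .of_forall fun ζ => by fun_prop
  · refine (norm_integral_le_of_norm_le (hN.norm.const_mul (C * (1 + ‖a‖) ^ N))
      (.of_forall fun ζ => hC ζ a)).trans (le_of_eq ?_)
    rw [integral_const_mul]
    ring

theorem TemperedDensity.integral_mul_convS {F : Rd d → ℂ} (hF : TemperedDensity F)
    (k h : 𝓢(Rd d, ℂ)) :
    ∫ ζ, F ζ * convS k h ζ = ∫ a, (∫ ζ, F ζ * k (ζ - a)) * h a := by
  simp_rw [convS_apply, ← integral_const_mul, ← integral_mul_const]
  rw [integral_integral_swap]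
  · simp_rw [mul_assoc]
  · have hm := hF.aestronglyMeasurable
    obtain ⟨N, hN⟩ := hF
    obtain ⟨C, -, hC⟩ := exists_norm_mul_transS_le (F := F) (N := N) k
    refine ((hN.norm.mul_prod (integrable_one_add_norm_pow_mul h N)).const_mul C).mono' ?_
      (.of_forall fun p => ?_)
    · refine (AEStronglyMeasurable.comp_fst hm).mul ?_
      exact Continuous.aestronglyMeasurable (by fun_prop)
    · simp only [Function.uncurry]
      rw [← mul_assoc, norm_mul]
      calc _ ≤ C * (1 + ‖p.2‖) ^ N * ‖((1 + ‖p.1‖) ^ N)⁻¹ • F p.1‖ * ‖h p.2‖ := by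
            gcongr
            exact hC _ _
        _ = _ := by ring

/-! ### The Fourier transform of a localized tempered distribution -/

theorem memLp_two_of_norm_le {w : Rd d → ℝ} (hw : Continuous w) {C : ℝ}
    (hC : ∀ ζ, ‖w ζ‖ ≤ C * ((1 + ‖ζ‖) ^ (d + 1))⁻¹) : MemLp w 2 := by
  rw [memLp_two_iff_integrable_sq hw.aestronglyMeasurable]
  refine (integrable_inv_one_add_norm_pow.const_mul (C ^ 2)).mono'
    (by fun_prop) (.of_forall fun ζ => ?_)
  have h1 : ((1 + ‖ζ‖) ^ (d + 1))⁻¹ ≤ 1 :=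
    inv_le_one_of_one_le₀ (one_le_pow₀ (by linarith [norm_nonneg ζ]))
  have h2 : 0 ≤ ((1 + ‖ζ‖) ^ (d + 1))⁻¹ := by positivity
  calc ‖w ζ ^ 2‖ = ‖w ζ‖ ^ 2 := norm_pow _ _
    _ ≤ (C * ((1 + ‖ζ‖) ^ (d + 1))⁻¹) ^ 2 := by
        gcongr
        exact hC ζ
    _ = C ^ 2 * (((1 + ‖ζ‖) ^ (d + 1))⁻¹ * ((1 + ‖ζ‖) ^ (d + 1))⁻¹) := by ring
    _ ≤ C ^ 2 * (((1 + ‖ζ‖) ^ (d + 1))⁻¹ * 1) := by gcongr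
    _ = _ := by rw [mul_one]

/-- A linear functional on the Schwartz space that is bounded by a weighted `L¹` norm is
given by a density. -/
theorem exists_temperedDensity_of_bound (A : 𝓢(Rd d, ℂ) →ₗ[ℂ] ℂ) (n : ℕ) (C : ℝ) (hC0 : 0 ≤ C)
    (hA : ∀ h : 𝓢(Rd d, ℂ), ‖A h‖ ≤ C * ∫ v, (1 + ‖v‖) ^ n * ‖h v‖) :
    ∃ F : Rd d → ℂ, TemperedDensity F ∧ ∀ h, A h = ∫ ζ, F ζ * h ζ := by
  -- Since `n + (d + 1) ≤ 2 * m`, the weight `w` below is square integrable. Powers of `1 + ‖v‖ ^ 2`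
  -- are used because they are smooth and so preserve the Schwartz space.
  set m := n + d + 1
  set ω : Rd d → ℂ := fun v => (((1 + ‖v‖ ^ 2) ^ (m : ℝ) : ℝ) : ℂ) with hω
  set ω' : Rd d → ℂ := fun v => (((1 + ‖v‖ ^ 2) ^ (-(m : ℝ)) : ℝ) : ℂ) with hω'
  have hωt : ω.HasTemperateGrowth := by fun_prop
  have hωt' : ω'.HasTemperateGrowth := by fun_prop
  have hmul : ∀ v, ω' v * ω v = 1 := fun v => by
    simp only [hω, hω']
    rw [← Complex.ofReal_mul, ← Real.rpow_add (by positivity)]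
    simp
  set w : Rd d → ℝ := fun v => (1 + ‖v‖) ^ n * (1 + ‖v‖ ^ 2) ^ (-(m : ℝ)) with hwdef
  have hwc : Continuous w := by
    refine Continuous.mul (by fun_prop) ?_
    exact (Function.hasTemperateGrowth_one_add_norm_sq_rpow (Rd d) (-(m : ℝ))).1.continuous
  have hbr : ∀ v : Rd d, (1 + ‖v‖) ^ (2 * m) ≤ 2 ^ m * (1 + ‖v‖ ^ 2) ^ m := fun v => by
    rw [pow_mul, ← mul_pow]
    gcongr
    nlinarith [sq_nonneg (1 - ‖v‖)]
  have hw : MemLp w 2 := by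
    refine memLp_two_of_norm_le hwc (C := 2 ^ m) fun v => ?_
    have h1 : (1:ℝ) ≤ 1 + ‖v‖ := by linarith [norm_nonneg v]
    have h2 : 0 < (1 + ‖v‖ ^ 2) ^ m := by positivity
    have h3 : 0 < (1 + ‖v‖) ^ (d + 1) := by positivity
    rw [Real.norm_of_nonneg (by positivity), hwdef]
    simp only
    rw [Real.rpow_neg (by positivity), Real.rpow_natCast, ← div_eq_mul_inv, ← div_eq_mul_inv,
      div_le_div_iff₀ h2 h3, ← pow_add]
    exact (pow_le_pow_right₀ h1 (by omega)).trans (hbr v)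
  -- By Cauchy–Schwarz `B` is bounded for the plain `L²` norm. It extends to `L²`, and the Riesz
  -- representation gives its density; multiplying by `ω` returns to `A`.
  set B : 𝓢(Rd d, ℂ) →ₗ[ℂ] ℂ := A ∘ₗ (SchwartzMap.smulLeftCLM ℂ ω').toLinearMap with hB
  set e : 𝓢(Rd d, ℂ) →L[ℂ] Lp ℂ 2 (volume : Measure (Rd d)) := 
    SchwartzMap.toLpCLM ℂ ℂ 2 volume
  have hbound : ∀ k, ‖B k‖ ≤ (C * ‖hw.toLp‖) * ‖e k‖ := fun k => by
    refine (hA _).trans ?_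
    rw [mul_assoc]
    refine mul_le_mul_of_nonneg_left ?_ hC0
    have hk2 : MemLp (fun v => ‖k v‖) 2 := (k.memLp 2 volume).norm
    have h1 : ∫ v, (1 + ‖v‖) ^ n * ‖SchwartzMap.smulLeftCLM ℂ ω' k v‖ = ∫ v, ‖k v‖ * w v := by
      refine integral_congr_ae (.of_forall fun v => ?_)
      have h2 : ‖ω' v‖ = (1 + ‖v‖ ^ 2) ^ (-(m : ℝ)) := by
        simp only [hω', Complex.norm_real]
        exact Real.norm_of_nonneg (by positivity)
      simp only [SchwartzMap.smulLeftCLM_apply_apply hωt', smul_eq_mul, norm_mul, h2, hwdef]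
      ring
    have h2 : ∫ v, ‖k v‖ * w v = inner ℝ (hw.toLp) (hk2.toLp (fun v => ‖k v‖)) := by
      rw [L2.inner_def]
      refine integral_congr_ae ?_
      filter_upwards [hw.coeFn_toLp, hk2.coeFn_toLp] with v h3 h4
      rw [h3, h4]
      simp
    have h3 : ‖e k‖ = ‖hk2.toLp (fun v => ‖k v‖)‖ := by
      rw [Lp.norm_toLp, eLpNorm_norm]
      exact SchwartzMap.norm_toLp
    refine (h1.trans h2).trans_le ?_
    rw [h3]
    exact real_inner_le_norm _ _
  have hdense : DenseRange e := SchwartzMap.denseRange_toLpCLM (by simp)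
  set b := (InnerProductSpace.toDual ℂ (Lp ℂ 2 (volume : Measure (Rd d)))).symm
    (B.extendOfNorm e.toLinearMap) with hb
  have hrep : ∀ k, B k = ∫ ζ, (starRingEnd ℂ) (b ζ) * k ζ := fun k => by
    have h1 : B k = inner ℂ b (e k) := by
      rw [hb, InnerProductSpace.toDual_symm_apply]
      exact (LinearMap.extendOfNorm_eq hdense ⟨_, hbound⟩ k).symm
    rw [h1, L2.inner_def]
    refine integral_congr_ae ?_
    filter_upwards [k.coeFn_toLp 2 volume] with ζ h2
    rw [show e k ζ = k ζ from h2]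
    simp [mul_comm]
  -- The power `2 * m` cancels the growth of `ω`; the remaining `d + 1` is an `L²` factor making the
  -- product with `b` integrable.
  refine ⟨fun ζ => (starRingEnd ℂ) (b ζ) * ω ζ, ⟨2 * m + (d + 1), ?_⟩, fun h => ?_⟩
  · have hw2 : MemLp (fun ζ : Rd d => ((1 + ‖ζ‖) ^ (d + 1))⁻¹) 2 :=
      memLp_two_of_norm_le (continuous_inv_one_add_norm_pow _) (C := 1) fun ζ => by
        rw [Real.norm_of_nonneg (by positivity), one_mul]
    have hωc : Continuous ω := hωt.1.continuous
    refine ((Lp.memLp b).norm.integrable_mul hw2).mono' ?_ (.of_forall fun ζ => ?_)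
    · exact (continuous_inv_one_add_norm_pow _).aestronglyMeasurable.smul
        ((Complex.continuous_conj.comp_aestronglyMeasurable
          (Lp.memLp b).aestronglyMeasurable).mul hωc.aestronglyMeasurable)
    · have h1 : ‖ω ζ‖ ≤ (1 + ‖ζ‖) ^ (2 * m) := by
        simp only [hω, Complex.norm_real]
        rw [Real.norm_of_nonneg (by positivity), Real.rpow_natCast, pow_mul]
        gcongr
        nlinarith [norm_nonneg ζ]
      rw [norm_smul, norm_mul, RCLike.norm_conj, Real.norm_of_nonneg (by positivity), pow_add,
        mul_inv]
      calc _ ≤ (((1 + ‖ζ‖) ^ (2 * m))⁻¹ * ((1 + ‖ζ‖) ^ (d + 1))⁻¹) *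
            (‖b ζ‖ * (1 + ‖ζ‖) ^ (2 * m)) := by gcongr
        _ = ‖b ζ‖ * ((1 + ‖ζ‖) ^ (d + 1))⁻¹ := by
          have : 0 < (1 + ‖ζ‖) ^ (2 * m) := by positivity
          field_simp
  · have h1 : h = SchwartzMap.smulLeftCLM ℂ ω' (SchwartzMap.smulLeftCLM ℂ ω h) := by
      ext v
      simp only [SchwartzMap.smulLeftCLM_apply_apply hωt, SchwartzMap.smulLeftCLM_apply_apply hωt',
        smul_eq_mul, ← mul_assoc, hmul, one_mul]
    rw [show A h = B (SchwartzMap.smulLeftCLM ℂ ω h) by simp [hB, ← h1], hrep]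
    refine integral_congr_ae (.of_forall fun v => ?_)
    simp only [SchwartzMap.smulLeftCLM_apply_apply hωt, smul_eq_mul, mul_assoc]

theorem exists_temperedDensity_mulS (u : 𝓢'(Rd d, ℂ)) (χ : 𝓢(Rd d, ℂ)) :
    ∃ F : Rd d → ℂ, TemperedDensity F ∧
      ∀ h, u (mulS χ (fourierS d h)) = ∫ ζ, F ζ * h ζ := by
  obtain ⟨n, C, hC0, hC⟩ := exists_norm_mulS_fourierS_le u χ
  exact exists_temperedDensity_of_bound
    ((u : 𝓢(Rd d, ℂ) →ₗ[ℂ] ℂ) ∘ₗ ((mulS χ).comp (fourierS d)).toLinearMap) n C hC0 hC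

/-- Smooth cutoff functions. -/
theorem exists_cutoff {K : Set (Rd d)} (hK : IsCompact K) :
    ∃ χ : 𝓢(Rd d, ℂ), HasCompactSupport χ ∧ ∃ U, IsOpen U ∧ K ⊆ U ∧ ∀ y ∈ U, χ y = 1 := by
  obtain ⟨f, hf, -, hs, h1⟩ := exists_contMDiff_support_eq_eq_one_iff
    (modelWithCornersSelf ℝ (Rd d)) (n := ⊤) (s := Metric.thickening 2 K)
    (t := Metric.cthickening 1 K) Metric.isOpen_thickening Metric.isClosed_cthickening
    (Metric.cthickening_subset_thickening' (by norm_num) (by norm_num) K)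
  have hc : HasCompactSupport fun y => (f y : ℂ) := by
    refine HasCompactSupport.of_support_subset_isCompact (hK.cthickening (r := 2)) fun y hy => ?_
    refine Metric.thickening_subset_cthickening 2 K ?_
    rw [← hs]
    simpa using hy
  refine ⟨hc.toSchwartzMap (Complex.ofRealCLM.contDiff.comp hf.contDiff), hc,
    Metric.thickening 1 K, Metric.isOpen_thickening,
    Metric.self_subset_thickening one_pos K, fun y hy => ?_⟩
  change ((f y : ℝ) : ℂ) = 1
  simp [(h1 y).1 (Metric.thickening_subset_cthickening 1 K hy)]

theorem exists_mulS_eq_self {χ : 𝓢(Rd d, ℂ)} (hχ : HasCompactSupport χ) :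
    ∃ χ₁ : 𝓢(Rd d, ℂ), HasCompactSupport χ₁ ∧ mulS χ χ₁ = χ := by
  obtain ⟨χ₁, hc, U, -, hKU, hU⟩ := exists_cutoff (K := tsupport χ) hχ
  refine ⟨χ₁, hc, ?_⟩
  ext y
  by_cases hy : y ∈ tsupport χ
  · simp [hU y (hKU hy)]
  · simp [image_eq_zero_of_notMem_tsupport hy]

/-- The Fourier transform of `χ u` is the function `ξ ↦ u (χ exp(-i⟨·, ξ⟩))`. -/
theorem localized_fourier (u : 𝓢'(Rd d, ℂ)) {χ : 𝓢(Rd d, ℂ)} (hχ : HasCompactSupport χ) :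
    (PolyGrowth fun ξ => u (modS ξ χ)) ∧
      ∀ h, u (mulS χ (fourierS d h)) = ∫ ξ, u (modS ξ χ) * h ξ := by
  obtain ⟨χ₁, -, h1⟩ := exists_mulS_eq_self hχ
  obtain ⟨F, hF, hFu⟩ := exists_temperedDensity_mulS u χ
  have h2 : ∀ ξ, u (modS ξ χ) = ∫ ζ, F ζ * fourierInvS d χ₁ (ζ - ξ) := fun ξ => by
    -- Because `χ = χ χ₁`, the rough density `F` enters only averaged against a translated Schwartz
    -- function, which makes the result continuous.
    have : modS ξ χ = mulS χ (fourierS d (transS ξ (fourierInvS d χ₁))) := by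
      rw [fourierS_transS, fourierS_fourierInvS, ← modS_mulS, h1]
    rw [this, hFu]
    rfl
  refine ⟨by simpa only [h2] using hF.polyGrowth_conv (fourierInvS d χ₁), fun h => ?_⟩
  -- The extra factor `χ₁` changes nothing and is a convolution on the Fourier side; Fubini moves it
  -- from `h` to `F`.
  have h3 : mulS χ (fourierS d h) = mulS χ (fourierS d (convS (fourierInvS d χ₁) h)) := by
    rw [fourierS_convS, fourierS_fourierInvS]
    ext y
    conv_lhs => rw [← h1]
    simp [mul_assoc]
  rw [h3, hFu, hF.integral_mul_convS]
  simp_rw [h2]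

/-- The compactly supported part satisfies `v = χ v`, so `u - χ u` is the Schwartz function `(1 - χ)
f`. -/
theorem exists_localization {u : 𝓢'(Rd d, ℂ)} (hu : MemEPrimeAddSchwartz u) :
    ∃ χ f : 𝓢(Rd d, ℂ), HasCompactSupport χ ∧ ∀ g, u g = u (mulS χ g) + ∫ y, f y * g y := by
  obtain ⟨v, f, ⟨K, hK, hv⟩, rfl⟩ := hu
  obtain ⟨χ, hc, U, hUo, hKU, hU⟩ := exists_cutoff hK
  refine ⟨χ, f - mulS χ f, hc, fun g => ?_⟩
  have h1 : v (g - mulS χ g) = 0 := by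
    -- The cutoff is 1 on an open neighbourhood of `K`, so even the closed support of `g - χ g`
    -- misses `K`.
    refine hv _ fun y hy hyK => ?_
    rw [tsupport, mem_closure_iff] at hy
    obtain ⟨z, hzU, hz⟩ := hy U hUo (hKU hyK)
    simp [hU z hzU] at hz
  rw [map_sub, sub_eq_zero] at h1
  have h2 : ∀ k : 𝓢(Rd d, ℂ), (v + SchwartzMap.toTemperedDistributionCLM (Rd d) ℂ volume f) k =
      v k + ∫ y, k y * f y := fun k => by
    simp_rw [← smul_eq_mul]
    rw [← SchwartzMap.toTemperedDistributionCLM_apply_apply volume f k]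
    rfl
  have h3 : ∀ k l : 𝓢(Rd d, ℂ), Integrable fun y => k y * l y := fun k l => by
    exact (mulS k l).integrable.congr (.of_forall fun y => mulS_apply k l y)
  rw [h2, h2, h1, add_assoc, ← integral_add (h3 (mulS χ g) f) (h3 (f - mulS χ f) g)]
  congr 2
  ext y
  simp
  ring

/-- The function `G` is the Fourier transform of `u`, and it is continuous of polynomial growth. -/
def HasFourierDensity (u : 𝓢'(Rd d, ℂ)) (G : Rd d → ℂ) : Prop :=
  PolyGrowth G ∧ ∀ h, u (fourierS d h) = ∫ ζ, G ζ * h ζ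

theorem hasFourierDensity_of_localization {u : 𝓢'(Rd d, ℂ)} {χ f : 𝓢(Rd d, ℂ)}
    (hχ : HasCompactSupport χ) (hu : ∀ g, u g = u (mulS χ g) + ∫ y, f y * g y) :
    HasFourierDensity u fun ξ => u (modS ξ χ) + fourierS d f ξ := by
  obtain ⟨h1, h2⟩ := localized_fourier u hχ
  have h3 := polyGrowth_schwartz (fourierS d f)
  refine ⟨h1.add h3, fun h => ?_⟩
  rw [hu, h2, integral_mul_fourierS, ← integral_add (h1.temperedDensity.integrable_mul h)
    (h3.temperedDensity.integrable_mul h)]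
  simp_rw [add_mul]

theorem HasFourierDensity.apply_modS {u : 𝓢'(Rd d, ℂ)} {G : Rd d → ℂ}
    (hG : HasFourierDensity u G) (g : 𝓢(Rd d, ℂ)) (ξ : Rd d) :
    u (modS ξ g) = ∫ ζ, G (ζ + ξ) * fourierInvS d g ζ := by
  rw [← fourierS_fourierInvS (modS ξ g), hG.2, fourierInvS_modS,
    ← integral_add_right_eq_self _ ξ]
  simp

theorem HasFourierDensity.stft_eq {u : 𝓢'(Rd d, ℂ)} {G : Rd d → ℂ}
    (hG : HasFourierDensity u G) (φ : 𝓢(Rd d, ℂ)) (x ξ : Rd d) :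
    stft φ u x ξ = ∫ ζ, G (ζ + ξ) * (character x ζ * fourierInvS d (conjS φ) ζ) := by
  rw [GaborWF.stft_eq, hG.apply_modS, fourierInvS_transS]
  simp

theorem localized_apply_modS (u : 𝓢'(Rd d, ℂ)) {χ : 𝓢(Rd d, ℂ)} (hχ : HasCompactSupport χ)
    (g : 𝓢(Rd d, ℂ)) (ξ : Rd d) :
    u (mulS χ (modS ξ g)) = ∫ ζ, u (modS (ζ + ξ) χ) * fourierInvS d g ζ := by
  rw [← fourierS_fourierInvS (modS ξ g), (localized_fourier u hχ).2, fourierInvS_modS,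
    ← integral_add_right_eq_self _ ξ]
  simp

/-! ### Rapid decay on cones -/

/-- Rapid decay on a set. -/
def RapidOn (G : Rd d → ℂ) (Γ : Set (Rd d)) : Prop :=
  ∀ N : ℕ, ∃ C : ℝ, ∀ ξ ∈ Γ, (1 + ‖ξ‖) ^ N * ‖G ξ‖ ≤ C

theorem bracket_le (ξ : Rd d) : bracket ξ ≤ 1 + ‖ξ‖ :=
  Real.sqrt_le_iff.2 ⟨by positivity, by nlinarith [norm_nonneg ξ]⟩

theorem le_bracket (ξ : Rd d) : 1 + ‖ξ‖ ≤ 2 * bracket ξ := by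
  have h : (1 + ‖ξ‖) / 2 ≤ bracket ξ :=
    Real.le_sqrt_of_sq_le (by nlinarith [norm_nonneg ξ, sq_nonneg (1 - ‖ξ‖)])
  linarith

theorem phaseBracket_le (z : Rd d × Rd d) : phaseBracket z ≤ 1 + ‖z.1‖ + ‖z.2‖ :=
  Real.sqrt_le_iff.2 ⟨by positivity, by
    nlinarith [norm_nonneg z.1, norm_nonneg z.2, mul_nonneg (norm_nonneg z.1) (norm_nonneg z.2)]⟩

theorem le_phaseBracket (z : Rd d × Rd d) : 1 + ‖z.1‖ + ‖z.2‖ ≤ 2 * phaseBracket z := by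
  have h : (1 + ‖z.1‖ + ‖z.2‖) / 2 ≤ phaseBracket z := by
    refine Real.le_sqrt_of_sq_le ?_
    nlinarith [sq_nonneg (1 - ‖z.1‖), sq_nonneg (1 - ‖z.2‖), sq_nonneg (‖z.1‖ - ‖z.2‖)]
  linarith

theorem rapid_iff_of_weights {α : Type*} {p q : α → ℝ} (hp : ∀ a, 0 ≤ p a) (hq : ∀ a, 0 ≤ q a)
    (hpq : ∀ a, p a ≤ q a) (hqp : ∀ a, q a ≤ 2 * p a) (V : α → ℂ) (S : Set α) :
    (∀ N : ℕ, ∃ C : ℝ, ∀ a ∈ S, p a ^ N * ‖V a‖ ≤ C) ↔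
      ∀ N : ℕ, ∃ C : ℝ, ∀ a ∈ S, q a ^ N * ‖V a‖ ≤ C := by
  refine ⟨fun h N => ?_, fun h N => ?_⟩
  · obtain ⟨C, hC⟩ := h N
    refine ⟨2 ^ N * C, fun a ha => ?_⟩
    calc q a ^ N * ‖V a‖ ≤ (2 * p a) ^ N * ‖V a‖ := by
          gcongr
          exacts [hq a, hqp a]
      _ = 2 ^ N * (p a ^ N * ‖V a‖) := by ring
      _ ≤ _ := by
          gcongr
          exact hC a ha
  · obtain ⟨C, hC⟩ := h N
    refine ⟨C, fun a ha => le_trans ?_ (hC a ha)⟩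
    gcongr
    exacts [hp a, hpq a]

theorem rapidOn_iff_bracket (G : Rd d → ℂ) (Γ : Set (Rd d)) :
    (∀ N : ℕ, ∃ C : ℝ, ∀ ξ ∈ Γ, bracket ξ ^ N * ‖G ξ‖ ≤ C) ↔ RapidOn G Γ :=
  rapid_iff_of_weights (fun _ => Real.sqrt_nonneg _) (fun _ => by positivity) bracket_le
    le_bracket G Γ

theorem rapidOn_iff_phaseBracket (V : Rd d × Rd d → ℂ) (Γ : Set (Rd d × Rd d)) :
    (∀ N : ℕ, ∃ C : ℝ, ∀ z ∈ Γ, phaseBracket z ^ N * ‖V z‖ ≤ C) ↔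
      ∀ N : ℕ, ∃ C : ℝ, ∀ z ∈ Γ, (1 + ‖z.1‖ + ‖z.2‖) ^ N * ‖V z‖ ≤ C :=
  rapid_iff_of_weights (fun _ => Real.sqrt_nonneg _) (fun _ => by positivity) phaseBracket_le
    le_phaseBracket V Γ

/-- The open cone spanned by a ball. -/
def coneBall (η : Rd d) (r : ℝ) : Set (Rd d) := {ξ | ∃ t : ℝ, 0 < t ∧ t • ξ ∈ Metric.ball η r}

theorem isOpenCone_coneBall {η : Rd d} {r : ℝ} (hr : r ≤ ‖η‖) : IsOpenCone (coneBall η r) := by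
  refine ⟨?_, ?_, ?_⟩
  · have : coneBall η r = ⋃ t ∈ Set.Ioi (0 : ℝ), (fun ξ => t • ξ) ⁻¹' Metric.ball η r := by
      ext ξ; simp [coneBall]
    rw [this]
    exact isOpen_biUnion fun t _ => Metric.isOpen_ball.preimage (by fun_prop)
  · rintro ⟨t, -, ht⟩
    rw [smul_zero, mem_ball_iff_norm, zero_sub, norm_neg] at ht
    linarith
  · rintro ξ ⟨t, ht, h⟩ s hs
    exact ⟨t / s, by positivity, by rwa [smul_smul, div_mul_cancel₀ _ hs.ne']⟩

theorem mem_coneBall_self {η : Rd d} {r : ℝ} (hr : 0 < r) : η ∈ coneBall η r :=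
  ⟨1, one_pos, by simpa using hr⟩

theorem IsOpenCone.ne_zero {V : Type*} [TopologicalSpace V] [AddCommGroup V] [Module ℝ V]
    {Γ : Set V} (h : IsOpenCone Γ) {η : V} (hη : η ∈ Γ) : η ≠ 0 := by
  rintro rfl
  exact h.2.1 hη

theorem IsOpenCone.inter {V : Type*} [TopologicalSpace V] [AddCommGroup V] [Module ℝ V]
    {Γ Γ' : Set V} (h : IsOpenCone Γ) (h' : IsOpenCone Γ') : IsOpenCone (Γ ∩ Γ') :=
  ⟨h.1.inter h'.1, fun h0 => h.2.1 h0.1,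
    fun z hz t ht => ⟨h.2.2 z hz.1 t ht, h'.2.2 z hz.2 t ht⟩⟩

/-- If an open cone in phase space contains `(0, η)`, it contains a conic neighbourhood of the form
`{(x, ξ) : ξ ∈ Γ', |x| ≤ ε |ξ|}`. -/
theorem exists_cone_of_phase_cone {Γ : Set (Rd d × Rd d)} (hΓ : IsOpenCone Γ) {η : Rd d}
    (hη : ((0 : Rd d), η) ∈ Γ) :
    ∃ (Γ' : Set (Rd d)) (ε : ℝ), IsOpenCone Γ' ∧ η ∈ Γ' ∧ 0 < ε ∧
      ∀ ξ ∈ Γ', ∀ x : Rd d, ‖x‖ ≤ ε * ‖ξ‖ → (x, ξ) ∈ Γ := by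
  have hη0 : η ≠ 0 := fun h => hΓ.ne_zero hη (by rw [h]; rfl)
  obtain ⟨r, hr, hrΓ⟩ := Metric.isOpen_iff.1 hΓ.1 _ hη
  have hs : 0 < min r ‖η‖ := lt_min hr (norm_pos_iff.2 hη0)
  -- The minimum with `‖η‖` keeps the origin out of the cone. If `t • ξ` is in the ball, then `‖t •
  -- ξ‖ ≤ ‖η‖ + r`, and this aperture forces `‖t • x‖ ≤ r / 2`.
  refine ⟨coneBall η (min r ‖η‖), r / (2 * (‖η‖ + r)), isOpenCone_coneBall (min_le_right _ _),
    mem_coneBall_self hs, by positivity, ?_⟩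
  rintro ξ ⟨t, ht, hξ⟩ x hx
  have h1 : t • (x, ξ) ∈ Γ := by
    refine hrΓ ?_
    have h2 : ‖t • ξ - η‖ < r := (mem_ball_iff_norm.1 hξ).trans_le (min_le_left _ _)
    have h3 : ‖t • ξ‖ ≤ ‖η‖ + r := by
      have := norm_sub_norm_le (t • ξ) η
      linarith
    have h4 : ‖t • x‖ < r := by
      rw [norm_smul, Real.norm_of_nonneg ht.le] at h3 ⊢
      calc t * ‖x‖ ≤ t * (r / (2 * (‖η‖ + r)) * ‖ξ‖) := by gcongr
        _ = r / (2 * (‖η‖ + r)) * (t * ‖ξ‖) := by ring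
        _ ≤ r / (2 * (‖η‖ + r)) * (‖η‖ + r) := by gcongr
        _ = r / 2 := by field_simp
        _ < r := by linarith
    rw [mem_ball_iff_norm, Prod.norm_def]
    simpa using ⟨h4, h2⟩
  have h5 := hΓ.2.2 _ h1 t⁻¹ (inv_pos.2 ht)
  rwa [smul_smul, inv_mul_cancel₀ ht.ne', one_smul] at h5

/-- The pairs `(ζ, ξ)` with `ζ + ξ ∈ Γ` form an open cone in phase space containing `(0, η)`. -/
theorem exists_shrink {Γ : Set (Rd d)} (hΓ : IsOpenCone Γ) {η : Rd d} (hη : η ∈ Γ) :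
    ∃ (Γ' : Set (Rd d)) (ε : ℝ), IsOpenCone Γ' ∧ η ∈ Γ' ∧ 0 < ε ∧
      ∀ ξ ∈ Γ', ∀ ζ : Rd d, ‖ζ‖ ≤ ε * ‖ξ‖ → ζ + ξ ∈ Γ := by
  set Γp : Set (Rd d × Rd d) := {z | z.1 + z.2 ∈ Γ}
  have hp : IsOpenCone Γp := by
    refine ⟨hΓ.1.preimage (by fun_prop), fun h => hΓ.2.1 (by simpa [Γp] using h),
      fun z hz t ht => ?_⟩
    have := hΓ.2.2 _ hz t ht
    rwa [smul_add] at this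
  exact exists_cone_of_phase_cone hp (by simpa [Γp] using hη)

/-- A function of polynomial growth that decays rapidly on an open cone also does so, locally
uniformly in translations, on a smaller cone. -/
theorem exists_pointwise_shift_bound {G : Rd d → ℂ} (hG : PolyGrowth G) {Γ : Set (Rd d)}
    (hR : RapidOn G Γ) (hΓ : IsOpenCone Γ) {η : Rd d} (hη : η ∈ Γ) :
    ∃ Γ' : Set (Rd d), IsOpenCone Γ' ∧ η ∈ Γ' ∧ ∀ N : ℕ, ∃ (M : ℕ) (C : ℝ), 0 ≤ C ∧
      ∀ ξ ∈ Γ', ∀ ζ, (1 + ‖ξ‖) ^ N * ‖G (ζ + ξ)‖ ≤ C * (1 + ‖ζ‖) ^ M := by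
  obtain ⟨Γ', ε, hΓ', hη', hε, hsh⟩ := exists_shrink hΓ hη
  obtain ⟨-, P, C₂, hC₂0, hC₂⟩ := hG
  refine ⟨Γ', hΓ', hη', fun N => ?_⟩
  obtain ⟨C₁, hC₁⟩ := hR N
  have hC₁0 : 0 ≤ C₁ := le_trans (by positivity) (hC₁ η hη)
  set K := 1 + ε⁻¹
  refine ⟨N + 2 * P, C₁ + C₂ * K ^ (N + P), by positivity, fun ξ hξ ζ => ?_⟩
  have h1 : 1 ≤ 1 + ‖ζ‖ := by linarith [norm_nonneg ζ]
  -- A small shift stays in `Γ`, where `G` decays. For a large one `‖ξ‖ ≤ ε⁻¹ * ‖ζ‖`, so all `N + P`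
  -- powers of `ξ` become powers of `ζ`; with the `P` already in `ζ` this gives `N + 2 * P`.
  rcases le_or_gt ‖ζ‖ (ε * ‖ξ‖) with h | h
  · have h2 := one_add_norm_pow_le ξ (-ζ) N
    rw [sub_neg_eq_add, norm_neg, add_comm ξ ζ] at h2
    calc (1 + ‖ξ‖) ^ N * ‖G (ζ + ξ)‖
        ≤ ((1 + ‖ζ + ξ‖) ^ N * (1 + ‖ζ‖) ^ N) * ‖G (ζ + ξ)‖ := by gcongr
      _ = ((1 + ‖ζ + ξ‖) ^ N * ‖G (ζ + ξ)‖) * (1 + ‖ζ‖) ^ N := by ring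
      _ ≤ C₁ * (1 + ‖ζ‖) ^ (N + 2 * P) := by
          have h3 : (1 + ‖ζ‖) ^ N ≤ (1 + ‖ζ‖) ^ (N + 2 * P) := pow_le_pow_right₀ h1 (by omega)
          exact mul_le_mul (hC₁ _ (hsh ξ hξ ζ h)) h3 (by positivity) hC₁0
      _ ≤ _ := by
          gcongr
          exact le_add_of_nonneg_right (by positivity)
  · have h2 : 1 + ‖ξ‖ ≤ K * (1 + ‖ζ‖) := by
      have h3 : ‖ξ‖ ≤ ε⁻¹ * ‖ζ‖ := by
        rw [inv_mul_eq_div, le_div_iff₀ hε]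
        linarith
      have h4 : 0 < ε⁻¹ := inv_pos.2 hε
      simp only [K]
      nlinarith [norm_nonneg ζ]
    have h3 : ‖G (ζ + ξ)‖ ≤ C₂ * ((1 + ‖ζ‖) * (1 + ‖ξ‖)) ^ P :=
      (hC₂ _).trans (by gcongr; exact one_add_norm_add_le ζ ξ)
    calc (1 + ‖ξ‖) ^ N * ‖G (ζ + ξ)‖ ≤ (1 + ‖ξ‖) ^ N * (C₂ * ((1 + ‖ζ‖) * (1 + ‖ξ‖)) ^ P) := by
          gcongr
      _ = C₂ * (1 + ‖ζ‖) ^ P * (1 + ‖ξ‖) ^ (N + P) := by rw [mul_pow, pow_add]; ring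
      _ ≤ C₂ * (1 + ‖ζ‖) ^ P * (K * (1 + ‖ζ‖)) ^ (N + P) := by gcongr
      _ = C₂ * K ^ (N + P) * (1 + ‖ζ‖) ^ (N + 2 * P) := by
          rw [mul_pow, two_mul, ← add_assoc, pow_add _ (N + P) P]; ring
      _ ≤ _ := by
          gcongr
          exact le_add_of_nonneg_left hC₁0

/-- Only the modulus of `m` is prescribed, so the constant is uniform over the phases `exp(i⟨x,
ζ⟩)`, hence over `x`. -/
theorem exists_cone_integral_shift {G : Rd d → ℂ} (hG : PolyGrowth G) {Γ : Set (Rd d)}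
    (hR : RapidOn G Γ) (hΓ : IsOpenCone Γ) {η : Rd d} (hη : η ∈ Γ) :
    ∃ Γ' : Set (Rd d), IsOpenCone Γ' ∧ η ∈ Γ' ∧ ∀ (k : 𝓢(Rd d, ℂ)) (N : ℕ), ∃ C : ℝ,
      ∀ ξ ∈ Γ', ∀ m : Rd d → ℂ, (∀ ζ, ‖m ζ‖ = ‖k ζ‖) →
        (1 + ‖ξ‖) ^ N * ‖∫ ζ, G (ζ + ξ) * m ζ‖ ≤ C := by
  obtain ⟨Γ', hΓ', hη', h⟩ := exists_pointwise_shift_bound hG hR hΓ hη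
  refine ⟨Γ', hΓ', hη', fun k N => ?_⟩
  obtain ⟨M, C, hC0, hC⟩ := h N
  refine ⟨∫ ζ, C * ((1 + ‖ζ‖) ^ M * ‖k ζ‖), fun ξ hξ m hm => ?_⟩
  have hpos : 0 < (1 + ‖ξ‖) ^ N := by positivity
  have h1 : ‖∫ ζ, G (ζ + ξ) * m ζ‖ ≤
      ∫ ζ, ((1 + ‖ξ‖) ^ N)⁻¹ * (C * ((1 + ‖ζ‖) ^ M * ‖k ζ‖)) := by
    refine norm_integral_le_of_norm_le
      (((integrable_one_add_norm_pow_mul k M).const_mul C).const_mul _) (.of_forall fun ζ => ?_)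
    rw [norm_mul, hm, inv_mul_eq_div, le_div_iff₀ hpos]
    calc _ = ((1 + ‖ξ‖) ^ N * ‖G (ζ + ξ)‖) * ‖k ζ‖ := by ring
      _ ≤ (C * (1 + ‖ζ‖) ^ M) * ‖k ζ‖ := by
          exact mul_le_mul_of_nonneg_right (hC ξ hξ ζ) (norm_nonneg _)
      _ = _ := by ring
  rw [integral_const_mul, inv_mul_eq_div, le_div_iff₀ hpos] at h1
  linarith

/-! ### The cone `Σ(u)` in terms of a density of the Fourier transform -/

theorem HasFourierDensity.eqOnOpen {u : 𝓢'(Rd d, ℂ)} {G : Rd d → ℂ} (hG : HasFourierDensity u G)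
    (Γ : Set (Rd d)) : EqOnOpen (fourierT u) G Γ :=
  ⟨hG.1.1.continuousOn, fun ψ _ _ => by rw [fourierT_apply, hG.2]⟩

/-- Testing against smooth functions supported in `Γ` gives equality almost everywhere, and
continuity upgrades it to equality everywhere. -/
theorem EqOnOpen.eqOn {v : 𝓢'(Rd d, ℂ)} {g G : Rd d → ℂ} {Γ : Set (Rd d)} (hΓ : IsOpen Γ)
    (hg : EqOnOpen v g Γ) (hG : EqOnOpen v G Γ) : Set.EqOn G g Γ := by
  have hc : ContinuousOn (fun ξ => G ξ - g ξ) Γ := hG.1.sub hg.1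
  have hae := hΓ.ae_eq_zero_of_integral_contDiff_smul_eq_zero (μ := volume)
    (hc.locallyIntegrableOn hΓ.measurableSet) fun f hf hfc hfΓ => ?_
  · have h1 : Set.EqOn (fun ξ => G ξ - g ξ) (fun _ => 0) Γ :=
      Measure.eqOn_open_of_ae_eq ((ae_restrict_iff' hΓ.measurableSet).2 hae) hΓ hc
        continuousOn_const
    exact fun ξ hξ => sub_eq_zero.1 (h1 hξ)
  · have hcs : HasCompactSupport fun y => (f y : ℂ) := hfc.comp_left (g := ((↑) : ℝ → ℂ)) rfl
    set ψ : 𝓢(Rd d, ℂ) := hcs.toSchwartzMap (Complex.ofRealCLM.contDiff.comp hf) with hψ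
    have hψf : ∀ y, ψ y = (f y : ℂ) := fun y => rfl
    have hts : tsupport ψ ⊆ Γ := by
      refine subset_trans (closure_mono fun y hy => ?_) hfΓ
      simpa [hψf] using hy
    have hi : ∀ {g' : Rd d → ℂ}, ContinuousOn g' Γ → Integrable fun ξ => g' ξ * ψ ξ :=
      fun {g'} hg' => by
      have h1 : IntegrableOn (fun ξ => g' ξ * ψ ξ) (tsupport ψ) :=
        ((hg'.mono hts).mul ψ.continuous.continuousOn).integrableOn_compact hcs
      refine (integrableOn_iff_integrable_of_support_subset fun ξ hξ => ?_).1 h1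
      exact subset_tsupport _ fun h0 => hξ (by simp [h0])
    have h2 : ∫ ξ, (G ξ * ψ ξ - g ξ * ψ ξ) = 0 := by
      rw [integral_sub (hi hG.1) (hi hg.1), ← hG.2 ψ hcs hts, ← hg.2 ψ hcs hts, sub_self]
    rw [← h2]
    refine integral_congr_ae (.of_forall fun ξ => ?_)
    simp only [hψf, Complex.real_smul]
    ring

theorem HasFourierDensity.mem_sigmaCone_iff {u : 𝓢'(Rd d, ℂ)} {G : Rd d → ℂ}
    (hG : HasFourierDensity u G) (η : Rd d) :
    η ∈ sigmaCone u ↔ η ≠ 0 ∧ ¬ ∃ Γ : Set (Rd d), IsOpenCone Γ ∧ η ∈ Γ ∧ RapidOn G Γ := by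
  simp only [sigmaCone, Set.mem_ofPred_eq, rapidOn_iff_bracket]
  refine and_congr_right fun _ => not_congr ⟨?_, ?_⟩
  · rintro ⟨Γ, g, hΓ, hη, he, hR⟩
    refine ⟨Γ, hΓ, hη, fun N => ?_⟩
    obtain ⟨C, hC⟩ := hR N
    exact ⟨C, fun ξ hξ => by rw [he.eqOn hΓ.1 (hG.eqOnOpen Γ) hξ]; exact hC ξ hξ⟩
  · rintro ⟨Γ, hΓ, hη, hR⟩
    exact ⟨Γ, G, hΓ, hη, hG.eqOnOpen Γ, hR⟩

/-! ### Microlocal regularity from decay of the Fourier transform -/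

theorem norm_character_mul (x ζ : Rd d) (c : ℂ) : ‖character x ζ * c‖ = ‖c‖ := by
  rw [norm_mul, norm_character, one_mul]

theorem notMem_gaborWF_of_rapidOn {u : 𝓢'(Rd d, ℂ)} {G : Rd d → ℂ} (hG : HasFourierDensity u G)
    (φ : 𝓢(Rd d, ℂ)) {Γ : Set (Rd d)} (hΓ : IsOpenCone Γ) {η : Rd d} (hη : η ∈ Γ)
    (hR : RapidOn G Γ) : ((0 : Rd d), η) ∉ gaborWF φ u := by
  obtain ⟨Γ', hΓ', hη', h⟩ := exists_cone_integral_shift hG.1 hR hΓ hη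
  rintro ⟨-, hn⟩
  -- On this cone the phase space weight is comparable to `1 + ‖z.2‖`.
  refine hn ⟨{z | z.2 ∈ Γ' ∧ ‖z.1‖ < ‖z.2‖}, ⟨?_, ?_, ?_⟩, ?_, ?_⟩
  · exact (hΓ'.1.preimage continuous_snd).inter (isOpen_lt continuous_fst.norm continuous_snd.norm)
  · rintro ⟨h0, -⟩
    exact hΓ'.2.1 h0
  · rintro z ⟨h1, h2⟩ t ht
    refine ⟨hΓ'.2.2 _ h1 t ht, ?_⟩
    simp only [Prod.smul_fst, Prod.smul_snd, norm_smul]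
    gcongr
    simpa using ht.ne'
  · exact ⟨hη', by simpa using hΓ'.ne_zero hη'⟩
  · refine (rapidOn_iff_phaseBracket (fun z => stft φ u z.1 z.2) _).2 fun N => ?_
    obtain ⟨C, hC⟩ := h (fourierInvS d (conjS φ)) N
    refine ⟨2 ^ N * C, fun z hz => ?_⟩
    rw [hG.stft_eq]
    have h1 : 1 + ‖z.1‖ + ‖z.2‖ ≤ 2 * (1 + ‖z.2‖) := by linarith [hz.2, norm_nonneg z.1]
    calc _ ≤ (2 * (1 + ‖z.2‖)) ^ N * _ := by gcongr
      _ = 2 ^ N * ((1 + ‖z.2‖) ^ N * _) := by rw [mul_pow, mul_assoc]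
      _ ≤ _ := by
          gcongr
          exact hC z.2 hz.1 _ fun ζ => norm_character_mul _ _ _

theorem notMem_classicalWF_of_rapidOn {u : 𝓢'(Rd d, ℂ)} {G : Rd d → ℂ}
    (hG : HasFourierDensity u G) {Γ : Set (Rd d)} (hΓ : IsOpenCone Γ) {η : Rd d} (hη : η ∈ Γ)
    (hR : RapidOn G Γ) (x : Rd d) : (x, η) ∉ classicalWF u := by
  obtain ⟨Γ', hΓ', hη', h⟩ := exists_cone_integral_shift hG.1 hR hΓ hη
  obtain ⟨φ, hφ, U, -, hU0, hU⟩ := exists_cutoff (isCompact_singleton (x := (0 : Rd d)))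
  rintro ⟨-, hn⟩
  refine hn ⟨φ, Γ', hφ, ?_, hΓ', hη', ?_⟩
  · simp [hU 0 (hU0 rfl)]
  · refine (rapidOn_iff_bracket (fun ξ => stft φ u x ξ) _).2 fun N => ?_
    obtain ⟨C, hC⟩ := h (fourierInvS d (conjS φ)) N
    refine ⟨C, fun ξ hξ => ?_⟩
    simp only [hG.stft_eq]
    exact hC ξ hξ _ fun ζ => norm_character_mul _ _ _

/-! ### Decay of the short-time Fourier transform in the space variable -/

theorem continuous_finset_sup_schwartzSeminorm (s : Finset (ℕ × ℕ)) :
    Continuous ((s.sup fun m => SchwartzMap.seminorm ℂ m.1 m.2 : Seminorm ℂ 𝓢(Rd d, ℂ)) :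
      𝓢(Rd d, ℂ) → ℝ) := by
  refine Finset.sup_induction (p := fun q : Seminorm ℂ 𝓢(Rd d, ℂ) => Continuous q) ?_ ?_ ?_
  · rw [Seminorm.coe_bot]
    exact continuous_const
  · intro p hp q hq
    rw [Seminorm.coe_sup]
    exact Continuous.sup hp hq
  · exact fun i _ => (schwartz_withSeminorms ℂ (Rd d) ℂ).continuous_seminorm i

/-- The Fourier transform of `χ T_x g` decays rapidly in `x`. -/
theorem exists_fourierInvS_mulS_transS_le (χ g : 𝓢(Rd d, ℂ)) (M N : ℕ) :
    ∃ C, 0 ≤ C ∧ ∀ x ζ, (1 + ‖x‖) ^ N * ((1 + ‖ζ‖) ^ M *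
      ‖fourierInvS d (mulS χ (transS x g)) ζ‖) ≤ C := by
  set p : Seminorm ℂ 𝓢(Rd d, ℂ) :=
    (Finset.Iic ((M, 0) : ℕ × ℕ)).sup fun m => SchwartzMap.seminorm ℂ m.1 m.2
  set q : Seminorm ℂ 𝓢(Rd d, ℂ) := p.comp (fourierInvS d).toLinearMap
  have hq : Continuous q :=
    (continuous_finset_sup_schwartzSeminorm _).comp (fourierInvS d).continuous
  obtain ⟨n, C, hC0, hC⟩ := exists_continuousSeminorm_mulS_le χ q hq N
  choose D hD0 hD using fun j => exists_decay_iteratedFDeriv g N j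
  set D' := ∑ j ∈ Finset.range (n + 1), D j
  have hD'0 : 0 ≤ D' := Finset.sum_nonneg fun j _ => hD0 j
  refine ⟨2 ^ M * (C * D'), by positivity, fun x ζ => ?_⟩
  have hx : 0 < (1 + ‖x‖) ^ N := by positivity
  have h1 : q (mulS χ (transS x g)) ≤ C * (D' / (1 + ‖x‖) ^ N) := by
    -- Decay of `g` at `y - x` yields decay in `x` times growth in `y`, and multiplication by `χ`
    -- tolerates that growth.
    refine hC _ _ (by positivity) fun j hj y => ?_
    have he : (transS x g : Rd d → ℂ) = fun y => g (y - x) := by ext; simp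
    rw [he, iteratedFDeriv_comp_sub, div_mul_eq_mul_div, le_div_iff₀ hx]
    have h2 : D j ≤ D' := Finset.single_le_sum (fun j _ => hD0 j) (Finset.mem_range.2 (by omega))
    have h3 := one_add_norm_pow_le x y N
    rw [norm_sub_rev] at h3
    calc _ ≤ ‖iteratedFDeriv ℝ j g (y - x)‖ * ((1 + ‖y - x‖) ^ N * (1 + ‖y‖) ^ N) := by gcongr
      _ = ((1 + ‖y - x‖) ^ N * ‖iteratedFDeriv ℝ j g (y - x)‖) * (1 + ‖y‖) ^ N := by ring
      _ ≤ _ := by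
          gcongr
          exact (hD j _).trans h2
  have h2 : (1 + ‖ζ‖) ^ M * ‖fourierInvS d (mulS χ (transS x g)) ζ‖ ≤
      2 ^ M * q (mulS χ (transS x g)) := by
    simpa [q, p] using SchwartzMap.one_add_le_sup_seminorm_apply (𝕜 := ℂ) (m := (M, 0)) (k := M)
      (n := 0) le_rfl le_rfl (fourierInvS d (mulS χ (transS x g))) ζ
  calc _ ≤ (1 + ‖x‖) ^ N * (2 ^ M * (C * (D' / (1 + ‖x‖) ^ N))) :=
        mul_le_mul_of_nonneg_left (h2.trans (by gcongr)) hx.le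
    _ = _ := by field_simp

/-- A window translated far away is small on the support of `χ` and barely overlaps `f`. The loss
`P` is the growth order of the transform of `χ u`, fixed before `N`. -/
theorem exists_stft_decay {u : 𝓢'(Rd d, ℂ)} {χ f : 𝓢(Rd d, ℂ)}
    (hχ : HasCompactSupport χ) (hu : ∀ g, u g = u (mulS χ g) + ∫ y, f y * g y)
    (φ : 𝓢(Rd d, ℂ)) :
    ∃ P : ℕ, ∀ N : ℕ, ∃ C, 0 ≤ C ∧ ∀ x ξ,
      (1 + ‖x‖) ^ N * ‖stft φ u x ξ‖ ≤ C * (1 + ‖ξ‖) ^ P := by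
  obtain ⟨χ₁, -, hχ₁⟩ := exists_mulS_eq_self hχ
  obtain ⟨-, P, C₀, hC₀0, hC₀⟩ := (localized_fourier u hχ).1
  refine ⟨P, fun N => ?_⟩
  obtain ⟨C₁, hC₁0, hC₁⟩ :=
    -- `P` powers absorb the growth of the transform of `χ u`; `d + 1` more make the integral
    -- converge.
    exists_fourierInvS_mulS_transS_le χ₁ (conjS φ) (P + (d + 1)) N
  obtain ⟨C₂, hC₂0, hC₂⟩ := exists_decay (conjS φ) N
  set I : ℝ := ∫ ζ : Rd d, ((1 + ‖ζ‖) ^ (d + 1))⁻¹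
  set J : ℝ := ∫ y, (1 + ‖y‖) ^ N * ‖f y‖
  have hI0 : 0 ≤ I := integral_nonneg fun ζ => by positivity
  have hJ0 : 0 ≤ J := integral_nonneg fun ζ => by positivity
  refine ⟨C₀ * C₁ * I + C₂ * J, by positivity, fun x ξ => ?_⟩
  have hx : 0 < (1 + ‖x‖) ^ N := by positivity
  have h1 : (1 + ‖x‖) ^ N * ‖u (mulS χ (modS ξ (transS x (conjS φ))))‖ ≤
      C₀ * C₁ * I * (1 + ‖ξ‖) ^ P := by
    have he : mulS χ (modS ξ (transS x (conjS φ))) =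
        mulS χ (modS ξ (mulS χ₁ (transS x (conjS φ)))) := by
      ext y
      conv_lhs => rw [← hχ₁]
      simp only [mulS_apply, modS_apply]
      ring
    have h2 : ‖u (mulS χ (modS ξ (transS x (conjS φ))))‖ ≤
        ∫ ζ : Rd d, (C₀ * C₁ * (1 + ‖ξ‖) ^ P / (1 + ‖x‖) ^ N) * ((1 + ‖ζ‖) ^ (d + 1))⁻¹ := by
      rw [he, localized_apply_modS u hχ]
      refine norm_integral_le_of_norm_le (integrable_inv_one_add_norm_pow.const_mul _)
        (.of_forall fun ζ => ?_)
      have hζ : 0 < (1 + ‖ζ‖) ^ (d + 1) := by positivity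
      rw [norm_mul, ← div_eq_mul_inv, div_div, le_div_iff₀ (by positivity)]
      have h3 : ‖u (modS (ζ + ξ) χ)‖ ≤ C₀ * ((1 + ‖ζ‖) * (1 + ‖ξ‖)) ^ P :=
        (hC₀ _).trans (by gcongr; exact one_add_norm_add_le ζ ξ)
      have h4 := hC₁ x ζ
      set k := ‖fourierInvS d (mulS χ₁ (transS x (conjS φ))) ζ‖
      have hk : 0 ≤ k := norm_nonneg _
      calc _ ≤ (C₀ * ((1 + ‖ζ‖) * (1 + ‖ξ‖)) ^ P) * k * ((1 + ‖x‖) ^ N * (1 + ‖ζ‖) ^ (d + 1)) := by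
            gcongr
        _ = C₀ * ((1 + ‖x‖) ^ N * ((1 + ‖ζ‖) ^ (P + (d + 1)) * k)) * (1 + ‖ξ‖) ^ P := by
            rw [mul_pow, pow_add _ P]; ring
        _ ≤ C₀ * C₁ * (1 + ‖ξ‖) ^ P := by gcongr
    rw [integral_const_mul] at h2
    calc _ ≤ (1 + ‖x‖) ^ N * (C₀ * C₁ * (1 + ‖ξ‖) ^ P / (1 + ‖x‖) ^ N * I) := by gcongr
      _ = _ := by field_simp
  have h2 : (1 + ‖x‖) ^ N * ‖∫ y, f y * modS ξ (transS x (conjS φ)) y‖ ≤ C₂ * J := by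
    have h3 : ‖∫ y, f y * modS ξ (transS x (conjS φ)) y‖ ≤
        ∫ y, (C₂ / (1 + ‖x‖) ^ N) * ((1 + ‖y‖) ^ N * ‖f y‖) := by
      refine norm_integral_le_of_norm_le ((integrable_one_add_norm_pow_mul f N).const_mul _)
        (.of_forall fun y => ?_)
      rw [modS_apply, norm_mul, norm_character_mul, transS_apply, div_mul_eq_mul_div,
        le_div_iff₀ hx]
      have h4 := one_add_norm_pow_le x y N
      rw [norm_sub_rev] at h4
      have h5 := hC₂ (y - x)
      calc _ ≤ ‖f y‖ * ‖conjS φ (y - x)‖ * ((1 + ‖y - x‖) ^ N * (1 + ‖y‖) ^ N) := by gcongr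
        _ = ((1 + ‖y - x‖) ^ N * ‖conjS φ (y - x)‖) * ((1 + ‖y‖) ^ N * ‖f y‖) := by ring
        _ ≤ _ := by gcongr
    rw [integral_const_mul] at h3
    calc _ ≤ (1 + ‖x‖) ^ N * (C₂ / (1 + ‖x‖) ^ N * J) := by gcongr
      _ = _ := by field_simp
  have h3 : C₂ * J ≤ C₂ * J * (1 + ‖ξ‖) ^ P :=
    le_mul_of_one_le_right (by positivity) (one_le_pow₀ (by linarith [norm_nonneg ξ]))
  rw [stft_eq, hu]
  calc _ ≤ (1 + ‖x‖) ^ N * (‖u (mulS χ (modS ξ (transS x (conjS φ))))‖ +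
        ‖∫ y, f y * modS ξ (transS x (conjS φ)) y‖) := by
        gcongr
        exact norm_add_le _ _
    _ = _ + _ := mul_add _ _ _
    _ ≤ C₀ * C₁ * I * (1 + ‖ξ‖) ^ P + C₂ * J * (1 + ‖ξ‖) ^ P := add_le_add h1 (h2.trans h3)
    _ = _ := by ring

theorem exists_stft_decay_off_axis {u : 𝓢'(Rd d, ℂ)} (hu : MemEPrimeAddSchwartz u)
    (φ : 𝓢(Rd d, ℂ)) {c : ℝ} (hc : 0 ≤ c) (N : ℕ) :
    ∃ C, 0 ≤ C ∧ ∀ x ξ, ‖ξ‖ ≤ c * ‖x‖ → (1 + ‖x‖ + ‖ξ‖) ^ N * ‖stft φ u x ξ‖ ≤ C := by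
  obtain ⟨χ, f, hχ, hu⟩ := exists_localization hu
  obtain ⟨P, hP⟩ := exists_stft_decay hχ hu φ
  -- For `‖ξ‖ ≤ c * ‖x‖` the loss in `ξ` is paid by `P` further powers of decay in `x`.
  obtain ⟨C, hC0, hC⟩ := hP (N + P)
  refine ⟨C * (1 + c) ^ (N + P), by positivity, fun x ξ h => ?_⟩
  have hx : 0 < 1 + ‖x‖ := by positivity
  have h1 : 1 + ‖x‖ + ‖ξ‖ ≤ (1 + c) * (1 + ‖x‖) := by nlinarith [norm_nonneg x]
  have h2 : 1 + ‖ξ‖ ≤ (1 + c) * (1 + ‖x‖) := by nlinarith [norm_nonneg x]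
  have h3 : ‖stft φ u x ξ‖ ≤ C * (1 + ‖ξ‖) ^ P / (1 + ‖x‖) ^ (N + P) := by
    rw [le_div_iff₀ (by positivity), mul_comm]
    exact hC x ξ
  calc _ ≤ ((1 + c) * (1 + ‖x‖)) ^ N *
        (C * ((1 + c) * (1 + ‖x‖)) ^ P / (1 + ‖x‖) ^ (N + P)) := by
        gcongr
        exact h3.trans (by gcongr)
    _ = _ := by
        rw [mul_pow, mul_pow, pow_add, pow_add]
        field_simp

theorem notMem_gaborWF_of_fst_ne_zero {u : 𝓢'(Rd d, ℂ)} (hu : MemEPrimeAddSchwartz u)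
    (φ : 𝓢(Rd d, ℂ)) {x : Rd d} (hx : x ≠ 0) (ξ : Rd d) : (x, ξ) ∉ gaborWF φ u := by
  have hx' : 0 < ‖x‖ := norm_pos_iff.2 hx
  set c := ‖ξ‖ / ‖x‖ + 1 with hc
  have hc0 : 0 ≤ c := by positivity
  rintro ⟨-, hn⟩
  refine hn ⟨{z | ‖z.2‖ < c * ‖z.1‖}, ⟨?_, ?_, ?_⟩, ?_, ?_⟩
  · exact isOpen_lt continuous_snd.norm (continuous_const.mul continuous_fst.norm)
  · simp
  · intro z hz t ht
    simp only [Set.mem_ofPred_eq, Prod.smul_fst, Prod.smul_snd, norm_smul,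
      Real.norm_of_nonneg ht.le] at hz ⊢
    nlinarith
  · simp only [Set.mem_ofPred_eq, hc]
    field_simp
    linarith
  · refine (rapidOn_iff_phaseBracket (fun z => stft φ u z.1 z.2) _).2 fun N => ?_
    obtain ⟨C, -, hC⟩ := exists_stft_decay_off_axis hu φ hc0 N
    exact ⟨C, fun z hz => hC z.1 z.2 (le_of_lt hz)⟩

/-! ### Decay of the Fourier transform from Gabor regularity -/

/-- Fourier inversion: a density of the Fourier transform is controlled by the integral in the space
variable of the short-time Fourier transform. -/
theorem HasFourierDensity.norm_mul_le_of_stft_le {u : 𝓢'(Rd d, ℂ)} {G : Rd d → ℂ}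
    (hG : HasFourierDensity u G) (φ : 𝓢(Rd d, ℂ)) (ξ : Rd d) {A : ℝ} (hA : 0 ≤ A)
    (h : ∀ x, ‖stft φ u x ξ‖ ≤ A * ((1 + ‖x‖) ^ (d + 1))⁻¹) (ζ : Rd d) :
    ‖G (ζ + ξ) * fourierInvS d (conjS φ) ζ‖ ≤
      A * ∫ x : Rd d, ((1 + ‖x‖) ^ (d + 1))⁻¹ := by
  set θ := fourierInvS d (conjS φ)
  set F : Rd d → ℂ := fun ζ => G (ζ + ξ) * θ ζ with hF
  have hFc : Continuous F := (hG.1.1.comp (by fun_prop)).mul θ.continuous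
  have hFi : Integrable F := by
    have h1 := (hG.1.temperedDensity.integrable_mul_transS θ ξ).comp_add_right ξ
    simpa using h1
  -- The dilation reconciles the two Fourier normalizations. As it increases norms, the decay
  -- assumed in `x` passes to `y`.
  have hV : ∀ y, 𝓕⁻ F y = stft φ u ((2 * Real.pi) • y) ξ := fun y => by
    rw [hG.stft_eq, Real.fourierInv_eq']
    refine integral_congr_ae (.of_forall fun v => ?_)
    simp only [hF, smul_eq_mul, character, inner_smul_right]
    rw [show Complex.I * ((2 * Real.pi * inner ℝ v y : ℝ) : ℂ) =
      ((2 * Real.pi * inner ℝ v y : ℝ) : ℂ) * Complex.I from mul_comm _ _]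
    ring
  have hle : ∀ y, ‖𝓕⁻ F y‖ ≤ A * ((1 + ‖y‖) ^ (d + 1))⁻¹ := fun y => by
    rw [hV]
    refine (h _).trans ?_
    have : ‖y‖ ≤ ‖(2 * Real.pi) • y‖ := by
      rw [norm_smul, Real.norm_of_nonneg (by positivity)]
      exact le_mul_of_one_le_left (norm_nonneg y) (by linarith [Real.pi_gt_three])
    gcongr
  have hFt : Integrable (𝓕 F) := by
    refine (integrable_inv_one_add_norm_pow.const_mul A).mono' ?_ (.of_forall fun y => ?_)
    · exact (VectorFourier.fourierIntegral_continuous Real.continuous_fourierChar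
        (by exact continuous_inner) hFi).aestronglyMeasurable
    · have := hle (-y)
      rwa [Real.fourierInv_eq_fourier_neg, neg_neg, norm_neg] at this
  have hinv : 𝓕 (𝓕⁻ F) ζ = F ζ := hFi.fourier_fourierInv_eq hFt hFc.continuousAt
  change ‖F ζ‖ ≤ _
  rw [← hinv, Real.fourier_eq, ← integral_const_mul]
  refine norm_integral_le_of_norm_le (integrable_inv_one_add_norm_pow.const_mul A)
    (.of_forall fun y => ?_)
  rw [Circle.norm_smul]
  exact hle y

theorem conjS_ne_zero {φ : 𝓢(Rd d, ℂ)} (hφ : φ ≠ 0) : conjS φ ≠ 0 := by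
  contrapose! hφ
  ext y
  have : conjS φ y = 0 := by rw [hφ]; rfl
  simpa [conjS_apply] using this

theorem HasFourierDensity.exists_rapidOn_of_notMem_gaborWF {u : 𝓢'(Rd d, ℂ)} {G : Rd d → ℂ}
    (hu : MemEPrimeAddSchwartz u) (hG : HasFourierDensity u G) {φ : 𝓢(Rd d, ℂ)} (hφ : φ ≠ 0)
    {η : Rd d} (hη0 : η ≠ 0) (hη : ((0 : Rd d), η) ∉ gaborWF φ u) :
    ∃ Γ : Set (Rd d), IsOpenCone Γ ∧ η ∈ Γ ∧ RapidOn G Γ := by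
  have hz : ((0 : Rd d), η) ≠ 0 := fun h => hη0 (congrArg Prod.snd h)
  simp only [gaborWF, Set.mem_ofPred_eq, not_and, not_not] at hη
  obtain ⟨Γ, hΓ, hηΓ, hR⟩ := hη hz
  rw [rapidOn_iff_phaseBracket (fun z => stft φ u z.1 z.2)] at hR
  obtain ⟨Γ', ε, hΓ', hη', hε, hsub⟩ := exists_cone_of_phase_cone hΓ hηΓ
  -- Gabor regularity covers `‖x‖ ≤ ε * ‖ξ‖` and the decay off the axis covers the rest, so all `x`
  -- can be integrated over.
  have hall : ∀ N, ∃ C, 0 ≤ C ∧ ∀ ξ ∈ Γ', ∀ x,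
      (1 + ‖x‖ + ‖ξ‖) ^ N * ‖stft φ u x ξ‖ ≤ C := fun N => by
    obtain ⟨C₁, hC₁⟩ := hR N
    obtain ⟨C₂, hC₂0, hC₂⟩ := exists_stft_decay_off_axis hu φ (c := ε⁻¹) (by positivity) N
    refine ⟨max C₁ C₂, le_max_of_le_right hC₂0, fun ξ hξ x => ?_⟩
    rcases le_or_gt ‖x‖ (ε * ‖ξ‖) with h | h
    · exact (hC₁ (x, ξ) (hsub ξ hξ x h)).trans (le_max_left _ _)
    · refine (hC₂ x ξ ?_).trans (le_max_right _ _)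
      rw [inv_mul_eq_div, le_div_iff₀ hε]
      linarith
  -- The transformed window may vanish at 0, so decay is first obtained for `G (ζ₀ + ·)`; the shift
  -- by `-ζ₀` at the end undoes this on a smaller cone.
  obtain ⟨ζ₀, hζ₀⟩ : ∃ ζ₀, fourierInvS d (conjS φ) ζ₀ ≠ 0 := by
    by_contra! h0
    refine conjS_ne_zero hφ ?_
    rw [← fourierS_fourierInvS (conjS φ), show fourierInvS d (conjS φ) = 0 from ?_, map_zero]
    ext y
    exact h0 y
  have hθ : 0 < ‖fourierInvS d (conjS φ) ζ₀‖ := norm_pos_iff.2 hζ₀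
  set I : ℝ := ∫ x : Rd d, ((1 + ‖x‖) ^ (d + 1))⁻¹
  have hR₁ : RapidOn (fun ξ => G (ζ₀ + ξ)) Γ' := fun N => by
    obtain ⟨C, hC0, hC⟩ := hall (N + (d + 1))
    refine ⟨C * I / ‖fourierInvS d (conjS φ) ζ₀‖, fun ξ hξ => ?_⟩
    have hξ0 : 0 < (1 + ‖ξ‖) ^ N := by positivity
    have h1 := hG.norm_mul_le_of_stft_le φ ξ (A := C / (1 + ‖ξ‖) ^ N) (by positivity)
      (fun x => ?_) ζ₀
    · rw [norm_mul, div_mul_eq_mul_div, le_div_iff₀ hξ0] at h1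
      rw [le_div_iff₀ hθ]
      calc _ = ‖G (ζ₀ + ξ)‖ * ‖fourierInvS d (conjS φ) ζ₀‖ * (1 + ‖ξ‖) ^ N := by ring
        _ ≤ _ := h1
    · have h2 := hC ξ hξ x
      have hx0 : 0 < (1 + ‖x‖) ^ (d + 1) := by positivity
      rw [← div_eq_mul_inv, div_div, le_div_iff₀ (by positivity), mul_comm]
      refine le_trans ?_ h2
      have h3 : 1 + ‖ξ‖ ≤ 1 + ‖x‖ + ‖ξ‖ := by linarith [norm_nonneg x]
      have h4 : 1 + ‖x‖ ≤ 1 + ‖x‖ + ‖ξ‖ := by linarith [norm_nonneg ξ]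
      rw [pow_add _ N]
      exact mul_le_mul_of_nonneg_right (mul_le_mul (pow_le_pow_left₀ (by positivity) h3 _)
        (pow_le_pow_left₀ (by positivity) h4 _) (by positivity) (by positivity)) (norm_nonneg _)
  have hGs : PolyGrowth fun ξ => G (ζ₀ + ξ) := by
    obtain ⟨hc, N, C, hC0, hC⟩ := hG.1
    refine ⟨hc.comp (by fun_prop), N, C * (1 + ‖ζ₀‖) ^ N, by positivity, fun ξ => ?_⟩
    calc _ ≤ C * (1 + ‖ζ₀ + ξ‖) ^ N := hC _
      _ ≤ C * ((1 + ‖ζ₀‖) * (1 + ‖ξ‖)) ^ N := by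
          gcongr
          exact one_add_norm_add_le _ _
      _ = _ := by rw [mul_pow, mul_assoc]
  obtain ⟨Γ'', hΓ'', hη'', hb⟩ := exists_pointwise_shift_bound hGs hR₁ hΓ' hη'
  refine ⟨Γ'', hΓ'', hη'', fun N => ?_⟩
  obtain ⟨M, C, -, hC⟩ := hb N
  refine ⟨C * (1 + ‖-ζ₀‖) ^ M, fun ξ hξ => ?_⟩
  simpa using hC ξ hξ (-ζ₀)

/-! ### Decay of the Fourier transform from classical microlocal regularity -/

theorem RapidOn.mono {G : Rd d → ℂ} {Γ Γ' : Set (Rd d)} (h : RapidOn G Γ) (hs : Γ' ⊆ Γ) :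
    RapidOn G Γ' := fun N => by
  obtain ⟨C, hC⟩ := h N
  exact ⟨C, fun ξ hξ => hC ξ (hs hξ)⟩

theorem RapidOn.add {F G : Rd d → ℂ} {Γ : Set (Rd d)} (hF : RapidOn F Γ) (hG : RapidOn G Γ) :
    RapidOn (fun ξ => F ξ + G ξ) Γ := fun N => by
  obtain ⟨C, hC⟩ := hF N
  obtain ⟨D, hD⟩ := hG N
  refine ⟨C + D, fun ξ hξ => ?_⟩
  calc _ ≤ (1 + ‖ξ‖) ^ N * (‖F ξ‖ + ‖G ξ‖) := by
        gcongr
        exact norm_add_le _ _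
    _ = (1 + ‖ξ‖) ^ N * ‖F ξ‖ + (1 + ‖ξ‖) ^ N * ‖G ξ‖ := mul_add _ _ _
    _ ≤ _ := add_le_add (hC ξ hξ) (hD ξ hξ)

theorem rapidOn_schwartz (k : 𝓢(Rd d, ℂ)) (Γ : Set (Rd d)) : RapidOn k Γ := fun N => by
  obtain ⟨C, -, hC⟩ := exists_decay k N
  exact ⟨C, fun ξ _ => hC ξ⟩

theorem exists_cone_rapidOn_sum {ι : Type*} (t : Finset ι) (F : ι → Rd d → ℂ) {η : Rd d}
    (hη : η ≠ 0)
    (h : ∀ i ∈ t, ∃ Γ : Set (Rd d), IsOpenCone Γ ∧ η ∈ Γ ∧ RapidOn (F i) Γ) :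
    ∃ Γ : Set (Rd d), IsOpenCone Γ ∧ η ∈ Γ ∧ RapidOn (fun ξ => ∑ i ∈ t, F i ξ) Γ := by
  classical
  induction t using Finset.induction_on with
  | empty =>
    exact ⟨_, isOpenCone_coneBall le_rfl, mem_coneBall_self (norm_pos_iff.2 hη),
      fun N => ⟨0, fun ξ _ => by simp⟩⟩
  | insert a s ha ih =>
    obtain ⟨Γ, hΓ, hηΓ, hR⟩ := ih fun i hi => h i (Finset.mem_insert_of_mem hi)
    obtain ⟨Γ', hΓ', hηΓ', hR'⟩ := h a (Finset.mem_insert_self a s)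
    refine ⟨Γ' ∩ Γ, hΓ'.inter hΓ, ⟨hηΓ', hηΓ⟩, ?_⟩
    simp only [Finset.sum_insert ha]
    exact (hR'.mono Set.inter_subset_left).add (hR.mono Set.inter_subset_right)

/-- A partition of a cutoff function into multiples of finitely many given windows. -/
theorem exists_partition {χ : 𝓢(Rd d, ℂ)} (hχ : HasCompactSupport χ) (φ : Rd d → 𝓢(Rd d, ℂ))
    (hφ : ∀ x, φ x 0 ≠ 0) :
    ∃ (t : Finset (Rd d)) (ψ : Rd d → 𝓢(Rd d, ℂ)),
      χ = ∑ x ∈ t, mulS (transS x (conjS (φ x))) (ψ x) := by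
  obtain ⟨t, -, ht⟩ := hχ.elim_nhds_subcover (fun x => {y | φ x (y - x) ≠ 0}) fun x _ => by
    refine (isOpen_ne.preimage (f := fun y => φ x (y - x)) (by fun_prop)).mem_nhds ?_
    simpa using hφ x
  -- A sum of squared moduli, positive on the support of `χ`: dividing `χ` by it and distributing
  -- the summands gives the partition.
  set Φ : Rd d → ℂ := fun y => ∑ x ∈ t, (starRingEnd ℂ) (φ x (y - x)) * φ x (y - x) with hΦ
  have hΦ0 : ∀ y ∈ tsupport χ, Φ y ≠ 0 := fun y hy => by
    obtain ⟨x, hx, hxy⟩ := Set.mem_iUnion₂.1 (ht hy)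
    have h1 : Φ y = ((∑ x ∈ t, ‖φ x (y - x)‖ ^ 2 : ℝ) : ℂ) := by
      rw [hΦ]
      push_cast
      exact Finset.sum_congr rfl fun x _ => Complex.conj_mul' _
    rw [h1, Complex.ofReal_ne_zero]
    refine (Finset.sum_pos' (fun x _ => by positivity) ⟨x, hx, ?_⟩).ne'
    exact pow_pos (norm_pos_iff.2 hxy) 2
  have hΦs : ContDiff ℝ (⊤ : ℕ∞) Φ := by
    have : Φ = fun y => (∑ x ∈ t, mulS (transS x (conjS (φ x))) (transS x (φ x)) y) := by
      ext y
      simp [hΦ, conjS_apply]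
    rw [this]
    exact ContDiff.sum fun x _ => SchwartzMap.smooth _ ⊤
  have hcs : HasCompactSupport fun y => χ y / Φ y := by
    refine hχ.mono fun y hy h0 => hy ?_
    simp [h0]
  have hsm : ContDiff ℝ (⊤ : ℕ∞) fun y => χ y / Φ y := by
    refine contDiff_iff_contDiffAt.2 fun y => ?_
    by_cases hy : y ∈ tsupport χ
    · simp only [div_eq_mul_inv]
      exact (χ.smooth ⊤).contDiffAt.mul (hΦs.contDiffAt.inv (hΦ0 y hy))
    · have : (fun y => χ y / Φ y) =ᶠ[nhds y] fun _ => 0 := by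
        filter_upwards [(isClosed_tsupport χ).isOpen_compl.mem_nhds hy] with z hz
        simp [image_eq_zero_of_notMem_tsupport hz]
      exact contDiffAt_const.congr_of_eventuallyEq this
  refine ⟨t, fun x => mulS (transS x (φ x)) (hcs.toSchwartzMap hsm), ?_⟩
  ext y
  rw [sum_apply]
  simp only [mulS_apply, transS_apply, conjS_apply, ← mul_assoc, ← Finset.sum_mul]
  change χ y = Φ y * (χ y / Φ y)
  by_cases hy : y ∈ tsupport χ
  · rw [mul_div_cancel₀ _ (hΦ0 y hy)]
  · simp [image_eq_zero_of_notMem_tsupport hy]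

theorem hasCompactSupport_transS_conjS {φ : 𝓢(Rd d, ℂ)} (hφ : HasCompactSupport φ) (x : Rd d) :
    HasCompactSupport (transS x (conjS φ)) := by
  have h1 : HasCompactSupport (conjS φ) :=
    hφ.comp_left (g := starRingEnd ℂ) (map_zero _)
  exact h1.comp_homeomorph (Homeomorph.subRight x)

/-- For fixed `x`, `ξ ↦ V_φ u(x, ξ)` is the Fourier transform of `u` cut off by the conjugate of
`φ(· - x)`. A further Schwartz factor `ψ x` only averages it over translates, and `f` contributes
decay in every direction. -/
theorem exists_rapidOn_of_notMem_classicalWF {u : 𝓢'(Rd d, ℂ)} {χ f : 𝓢(Rd d, ℂ)}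
    (hχ : HasCompactSupport χ) {η : Rd d} (hη0 : η ≠ 0) (hη : ∀ x, (x, η) ∉ classicalWF u) :
    ∃ Γ : Set (Rd d), IsOpenCone Γ ∧ η ∈ Γ ∧
      RapidOn (fun ξ => u (modS ξ χ) + fourierS d f ξ) Γ := by
  simp only [classicalWF, Set.mem_ofPred_eq, not_and, not_not] at hη
  choose φ Γ hφc hφ0 hΓ hηΓ hR using fun x => hη x hη0
  obtain ⟨t, ψ, hχt⟩ := exists_partition hχ φ hφ0
  have hsum : ∀ ξ, u (modS ξ χ) =
      ∑ x ∈ t, ∫ ζ, u (modS (ζ + ξ) (transS x (conjS (φ x)))) * fourierInvS d (ψ x) ζ := by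
    intro ξ
    conv_lhs => rw [hχt, map_sum, map_sum]
    refine Finset.sum_congr rfl fun x _ => ?_
    rw [modS_mulS, localized_apply_modS u (hasCompactSupport_transS_conjS (hφc x) x)]
  simp only [hsum]
  obtain ⟨Γ₀, hΓ₀, hηΓ₀, hR₀⟩ := exists_cone_rapidOn_sum t
    (fun x ξ => ∫ ζ, u (modS (ζ + ξ) (transS x (conjS (φ x)))) * fourierInvS d (ψ x) ζ)
    hη0 fun x _ => by
      have h1 := (rapidOn_iff_bracket (fun ξ => stft (φ x) u x ξ) (Γ x)).1 (hR x)
      simp only [stft_eq] at h1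
      obtain ⟨Γ', hΓ', hηΓ', h⟩ := exists_cone_integral_shift
        (localized_fourier u (hasCompactSupport_transS_conjS (hφc x) x)).1 h1 (hΓ x) (hηΓ x)
      refine ⟨Γ', hΓ', hηΓ', fun N => ?_⟩
      obtain ⟨C, hC⟩ := h (fourierInvS d (ψ x)) N
      exact ⟨C, fun ξ hξ => hC ξ hξ _ fun ζ => rfl⟩
  exact ⟨Γ₀, hΓ₀, hηΓ₀, hR₀.add (rapidOn_schwartz _ _)⟩

/-! ### Both wave front sets compared with the cone `Σ(u)` -/

theorem gaborWF_eq_sigmaCone {φ : 𝓢(Rd d, ℂ)} (hφ : φ ≠ 0) {u : 𝓢'(Rd d, ℂ)}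
    (hu : MemEPrimeAddSchwartz u) : gaborWF φ u = {(0 : Rd d)} ×ˢ sigmaCone u := by
  obtain ⟨χ, f, hχ, hloc⟩ := exists_localization hu
  have hG := hasFourierDensity_of_localization hχ hloc
  ext ⟨x, η⟩
  rw [Set.mem_prod, Set.mem_singleton_iff]
  by_cases hx : x = 0
  · subst hx
    simp only [true_and, hG.mem_sigmaCone_iff]
    refine ⟨fun h => ⟨fun h0 => h.1 (by simp [h0]), ?_⟩, ?_⟩
    · rintro ⟨Γ, hΓ, hη, hR⟩
      exact notMem_gaborWF_of_rapidOn hG φ hΓ hη hR h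
    · rintro ⟨h0, h⟩
      by_contra hn
      exact h (hG.exists_rapidOn_of_notMem_gaborWF hu hφ h0 hn)
  · simp only [hx, false_and, iff_false]
    exact notMem_gaborWF_of_fst_ne_zero hu φ hx η

theorem snd_image_classicalWF {u : 𝓢'(Rd d, ℂ)} (hu : MemEPrimeAddSchwartz u) :
    Prod.snd '' classicalWF u = sigmaCone u := by
  obtain ⟨χ, f, hχ, hloc⟩ := exists_localization hu
  have hG := hasFourierDensity_of_localization hχ hloc
  ext η
  rw [hG.mem_sigmaCone_iff]
  constructor
  · rintro ⟨⟨x, ξ⟩, h, rfl⟩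
    refine ⟨h.1, ?_⟩
    rintro ⟨Γ, hΓ, hη, hR⟩
    exact notMem_classicalWF_of_rapidOn hG hΓ hη hR x h
  · rintro ⟨h0, h⟩
    by_contra hn
    refine h (exists_rapidOn_of_notMem_classicalWF hχ h0 fun x hx => hn ⟨_, hx, rfl⟩)

end GaborWF

end

theorem mainTheorem1 (d : ℕ) (φ : 𝓢(GaborWF.Rd d, ℂ)) (hφ : φ ≠ 0)
    (u : 𝓢'(GaborWF.Rd d, ℂ)) (hu : GaborWF.MemEPrimeAddSchwartz u) :
    GaborWF.gaborWF φ u = {(0 : GaborWF.Rd d)} ×ˢ (Prod.snd '' GaborWF.classicalWF u) ∧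
    GaborWF.gaborWF φ u = {(0 : GaborWF.Rd d)} ×ˢ GaborWF.sigmaCone u := by
  rw [GaborWF.snd_image_classicalWF hu]
  exact ⟨GaborWF.gaborWF_eq_sigmaCone hφ hu, GaborWF.gaborWF_eq_sigmaCone hφ hu⟩
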